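/- **Setting.** Let $\mathcal X\subset\mathbb R^n$ be compact and convex, $U\subset\mathbb R^m$ compact with $0\in U$, and consider $$\dot x=f(x,u)=J(x)\nabla H(x)+G(x)u,$$ where $H:\mathbb R^n\to\mathbb R$ and $J(x)$ is skew-symmetric for $x\in\mathcal X$. Let $\mathcal U$ be the set of piecewise continuous controls $u:(0,\infty)\to U$, and let $\phi(t,x,u)$ be the state at time $t$. Assume that for all $x\in\mathcal X$, $u\in\mathcal U$ the trajectory exists and stays in $\mathcal X$ for all $t\ge0$. Assume further, with constants $L_H,L,\mu_H>0$: * $H$ is differentiable at every point of $\mathcal X$, $\nabla H$ is continuous on $\mathcal X$, and $\|\nabla H\|\le L_H$ on $\mathcal X$; * $\|f(x_1,u)-f(x_2,u)\|\le L\|x_1-x_2\|$ for $x_1,x_2\in\mathcal X$, $u\in U$; * $H(y)\ge H(x)+\nabla H(x)^\top(y-x)+\frac{\mu_H}2\|y-x\|^2$ for $x,y\in\mathcal X$. Let $S_0\subseteq\mathcal X$ be compact and $S_{\rm tgt}\subseteq\mathcal X$ compact and connected (non-empty). Write $H_{\min},H_{\max}$ for the minimum and maximum of $H$ on $S_{\rm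 tgt}$ and put $$\Delta H(x)=\Bigl|H(x)-\tfrac{H_{\max}+H_{\min}}2\Bigr|-\tfrac{H_{\max}-H_{\min}}2 .$$ Fix $0<\epsilon<\frac{H_{\max}-H_{\min}}2$ and let $H^\epsilon_{\rm tgt}=\{x\in\mathcal X:\Delta H(x)\le-\epsilon\}$. Define $$T_\epsilon(x,u)=\inf\{t>0:\phi(t,x,u)\in H^\epsilon_{\rm tgt}\},\qquad T^*_\epsilon(x)=\inf_{u\in\mathcal U}T_\epsilon(x,u),$$ $$v_\epsilon(x)=\sup_{u}\frac{\Delta H(x)-\Delta H(\phi(T_\epsilon(x,u),x,u))}{T_\epsilon(x,u)},$$ the supremum being over the $u\in\mathcal U$ with $T_\epsilon(x,u)<\infty$, and $\underline{v_\epsilon}=\inf_{x\in\mathcal X\setminus H^\epsilon_{\rm tgt}}v_\epsilon(x)$. Assume that from every $x\in\mathcal X\setminus H^\epsilon_{\rm tgt}$ the set $H^\epsilon_{\rm tgt}$ is reached in finite time by some control, that the infimum $T^*_\epsilon(x)$ is attained by some $u\in\mathcal U$ (an optimal control), and that $\underline{v_\epsilon}>0$. Let $v_0\in(0,\underline{v_\epsilon})$.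 **Energy layers.** Let $\Sigma_E=\{x\in\mathcal X:H(x)=E\}$. Call $E\in H(\mathcal X)$ relevant if the value of $\Delta H$ on $\Sigma_E$ is at most $\Delta H(x_0)$ for some $x_0\in S_0$. Assume that for each relevant $E$ there is a probability measure $\mu_E$ on $\Sigma_E$, invariant and ergodic under the zero-input flow $\phi(t,\cdot,0)$, whose support is all of $\Sigma_E$, and that every Borel set of states with relevant energy that is $\mu_E$-null for every relevant $E$ is Lebesgue-null. Assume finally that $\operatorname{int}(S_{\rm tgt})\cap\Sigma_E\ne\varnothing$ for every $E\in(H_{\min},H_{\max})$. **Chain policies.** Given an assignment set $\mathcal K=\{(x_i,r_i,u_i)\}_{i=1}^N$ with snippets $u_i$ on $(0,\tau_i]$, let $\mathrm{Supp}(\mathcal K)=\bigcup_i\{w:\|w-x_i\|\le r_i\}$. At a decision instant in state $x$, the chain policy $\pi_{\mathcal K}$ applies $u_i$ for time $\tau_i$, with $i$ minimizing $\|x-x_i\|/r_i$, if $x\in\mathrm{Supp}(\mathcal K)$; otherwise it applies the zero input for time $\tau_0$; then it decides again. **Theorem (Existence of a chain policy).** There is a finite assignment set $\mathcal K=\{(x_i,r_i,u_i)\}_{i=1}^N$,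 $N\ge1$, with $x_i\in\mathcal X\setminus H^\epsilon_{\rm tgt}$, with $u_i:(0,T^*_\epsilon(x_i)]\to U$ an optimal control from $x_i$, which steers $x_i$ to $\partial H^\epsilon_{\rm tgt}$ at time $\tau_i=T^*_\epsilon(x_i)\in(0,\infty)$, and with $$r_i=\frac{(v_\epsilon(x_i)-v_0)\,T^*_\epsilon(x_i)}{L_H\bigl(1+e^{L T^*_\epsilon(x_i)}\bigr)}>0,$$ such that the following hold. 1. *Reachability.* For every sufficiently small default duration $\tau_0>0$ (that is, $0<\tau_0\le\tau_{\max}$ for some $\tau_{\max}>0$) and every way of breaking ties in the choice of $i$, for Lebesgue-almost every $x_0\in S_0$ there is $t<\infty$ at which the trajectory from $x_0$ under $\pi_{\mathcal K}$ lies in $S_{\rm tgt}$. 2. *Sample complexity.* If $H_1,H_2$ are the minimum and maximum of $H$ on $\mathrm{Supp}(\mathcal K)\cap\mathcal X$, and $D_{\mathcal X}$ is the diameter of $\mathcal X$, then $$N\le(H_2-H_1)\,\frac{16L_H^2}{\mu_H\bigl(1-\frac{v_0}{\underline{v_\epsilon}}\bigr)^2}\,\frac{\exp\bigl(\frac{2L(L_HD_{\mathcal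 X}+\epsilon)}{\underline{v_\epsilon}}\bigr)}{\epsilon^2}.$$ -/

import Mathlib

open MeasureTheory Set Filter
open scoped ENNReal Topology Matrix

/-- `ℝⁿ` with the Euclidean norm. -/
abbrev Vec (n : ℕ) : Type := EuclideanSpace ℝ (Fin n)

/-- The lossless Hamiltonian control system `ẋ = J(x) ∇H(x) + G(x) u` with compact state set `X`,
compact input set `U` and skew-symmetric `J`. -/
structure HamiltonianSystem (n m : ℕ) where
  X : Set (Vec n)
  U : Set (Vec m)
  H : Vec n → ℝ
  J : Vec n → Matrix (Fin n) (Fin n) ℝ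
  G : Vec n → Matrix (Fin n) (Fin m) ℝ
  isCompact_X : IsCompact X
  isCompact_U : IsCompact U
  skew : ∀ x ∈ X, (J x)ᵀ = -J x

/-- `u` is piecewise continuous on `(0, T]`: continuous off a finite set, with one-sided limits. -/
def PiecewiseContinuousUpTo {m : ℕ} (u : ℝ → Vec m) (T : ℝ) : Prop :=
  (∃ F : Set ℝ, F.Finite ∧ ContinuousOn u (Ioc 0 T \ F)) ∧
  (∀ s ∈ Ico 0 T, ∃ l, Tendsto u (𝓝[>] s) (𝓝 l)) ∧
  (∀ s ∈ Ioc 0 T, ∃ l, Tendsto u (𝓝[<] s) (𝓝 l))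

namespace HamiltonianSystem

variable {n m : ℕ} (S : HamiltonianSystem n m)

/-- The vector field `f(x,u) = J(x) ∇H(x) + G(x) u`. -/
noncomputable def f (x : Vec n) (u : Vec m) : Vec n :=
  WithLp.toLp 2 (S.J x *ᵥ (gradient S.H x).ofLp + S.G x *ᵥ u.ofLp)

/-- Admissible control signals on `(0, ∞)`; values at times `t ≤ 0` are irrelevant. A control on
`(0, T]` is represented by any admissible extension of it. -/
def Admissible (u : ℝ → Vec m) : Prop :=
  (∀ t, 0 < t → u t ∈ S.U) ∧ ∀ T, 0 < T → PiecewiseContinuousUpTo u T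

/-- `ξ` is the state trajectory in `X` from `x` under the control `u`. -/
def IsTrajectory (x : Vec n) (u : ℝ → Vec m) (ξ : ℝ → Vec n) : Prop :=
  ContinuousOn ξ (Ici 0) ∧ (∀ t, 0 ≤ t → ξ t ∈ S.X) ∧
  ∀ t, 0 ≤ t → IntervalIntegrable (fun s => S.f (ξ s) (u s)) volume 0 t ∧
    ξ t = x + ∫ s in (0 : ℝ)..t, S.f (ξ s) (u s)

/-- Every initial state in `X` and every admissible control admit a state trajectory in `X` for all
positive times. -/
def ForwardComplete : Prop :=
  ∀ x ∈ S.X, ∀ u, S.Admissible u → ∃ ξ, S.IsTrajectory x u ξ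

open Classical in
/-- The state `φ(t, x, u)` at time `t` (unique when `f` is Lipschitz in the state on `X`). -/
noncomputable def flow (t : ℝ) (x : Vec n) (u : ℝ → Vec m) : Vec n :=
  if h : ∃ ξ, S.IsTrajectory x u ξ then h.choose t else x

/-- The zero-input flow `φ(t, x, 0)`. -/
noncomputable def zeroFlow (t : ℝ) (x : Vec n) : Vec n := S.flow t x (fun _ => 0)

/-- The energy layer `Σ_E`. -/
def energyLayer (E : ℝ) : Set (Vec n) := {x ∈ S.X | S.H x = E}

/-- `f(·, u)` is `L`-Lipschitz on `X`, uniformly in `u ∈ U`. -/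
def LipschitzDynamics (L : ℝ) : Prop :=
  ∀ u ∈ S.U, ∀ x ∈ S.X, ∀ y ∈ S.X, ‖S.f x u - S.f y u‖ ≤ L * ‖x - y‖

/-- `H` is continuously differentiable on `X` with gradient bounded by `LH`. -/
def BoundedGradient (LH : ℝ) : Prop :=
  (∀ x ∈ S.X, DifferentiableAt ℝ S.H x) ∧ ContinuousOn (gradient S.H) S.X ∧
  ∀ x ∈ S.X, ‖gradient S.H x‖ ≤ LH

/-- `H` is `μH`-strongly convex on `X`. -/
def StronglyConvexEnergy (μH : ℝ) : Prop :=
  ∀ x ∈ S.X, ∀ y ∈ S.X,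
    S.H x + inner ℝ (gradient S.H x) (y - x) + μH / 2 * ‖y - x‖ ^ 2 ≤ S.H y

/-! ### The target energy band -/

variable (Stgt : Set (Vec n))

/-- `H_min`, the minimum of `H` on the target set. -/
noncomputable def Hmin : ℝ := sInf (S.H '' Stgt)

/-- `H_max`, the maximum of `H` on the target set. -/
noncomputable def Hmax : ℝ := sSup (S.H '' Stgt)

/-- `H₊* = (H_max + H_min) / 2`. -/
noncomputable def Hplus : ℝ := (S.Hmax Stgt + S.Hmin Stgt) / 2

/-- `H₋* = (H_max - H_min) / 2`. -/
noncomputable def Hminus : ℝ := (S.Hmax Stgt - S.Hmin Stgt) / 2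

/-- Signed distance of an energy value to the target band. -/
noncomputable def levelDist (E : ℝ) : ℝ := |E - S.Hplus Stgt| - S.Hminus Stgt

/-- The energy distance `ΔH(x)`. -/
noncomputable def DH (x : Vec n) : ℝ := S.levelDist Stgt (S.H x)

/-- `H_tgt^ε`. -/
def Htgt (ε : ℝ) : Set (Vec n) := {x ∈ S.X | S.DH Stgt x ≤ -ε}

/-- The first hitting time `T_ε(x,u)` of `H_tgt^ε`; it is `⊤` if the set is never hit. -/
noncomputable def hitTime (ε : ℝ) (x : Vec n) (u : ℝ → Vec m) : ℝ≥0∞ :=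
  ⨅ t : {t : ℝ // 0 < t ∧ S.flow t x u ∈ S.Htgt Stgt ε}, ENNReal.ofReal t

/-- The optimal hitting time `T*_ε(x) = inf_u T_ε(x,u)`. -/
noncomputable def optHitTime (ε : ℝ) (x : Vec n) : ℝ≥0∞ :=
  ⨅ u : {u : ℝ → Vec m // S.Admissible u}, S.hitTime Stgt ε x u

/-- `T*_ε(x)` as a real number. -/
noncomputable def optTime (ε : ℝ) (x : Vec n) : ℝ := (S.optHitTime Stgt ε x).toReal

/-- `u` attains the optimal hitting time from `x`. -/
def IsOptimalControl (ε : ℝ) (x : Vec n) (u : ℝ → Vec m) : Prop :=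
  S.Admissible u ∧ S.hitTime Stgt ε x u = S.optHitTime Stgt ε x

/-- The average decrease rate `v_ε(x,u)` (used for controls with finite hitting time). -/
noncomputable def rateAlong (ε : ℝ) (x : Vec n) (u : ℝ → Vec m) : ℝ :=
  (S.DH Stgt x - S.DH Stgt (S.flow (S.hitTime Stgt ε x u).toReal x u)) /
    (S.hitTime Stgt ε x u).toReal

/-- The best decrease rate `v_ε(x) = sup_u v_ε(x,u)`. -/
noncomputable def bestRate (ε : ℝ) (x : Vec n) : ℝ :=
  sSup {v | ∃ u, S.Admissible u ∧ S.hitTime Stgt ε x u ≠ ⊤ ∧ v = S.rateAlong Stgt ε x u}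

/-- The minimal decrease rate, the infimum of `v_ε` over `X \ H_tgt^ε`. -/
noncomputable def minRate (ε : ℝ) : ℝ :=
  sInf (S.bestRate Stgt ε '' (S.X \ S.Htgt Stgt ε))

/-- `H_tgt^ε` can be reached from every state outside it. -/
def TargetBandReachable (ε : ℝ) : Prop :=
  ∀ x ∈ S.X \ S.Htgt Stgt ε, ∃ T, 0 < T ∧ ∃ u, S.Admissible u ∧ S.flow T x u ∈ S.Htgt Stgt ε

/-- Energies of states whose energy distance does not exceed the largest one on `S₀`. -/
def relevantEnergies (S₀ : Set (Vec n)) : Set ℝ :=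
  {E ∈ S.H '' S.X | ∃ x₀ ∈ S₀, S.levelDist Stgt E ≤ S.DH Stgt x₀}

/-- The certified radius at `x`. -/
noncomputable def certRadius (L LH ε v₀ : ℝ) (x : Vec n) : ℝ :=
  (S.bestRate Stgt ε x - v₀) * S.optTime Stgt ε x /
    (LH * (1 + Real.exp (L * S.optTime Stgt ε x)))

end HamiltonianSystem

/-! ### Invariant and ergodic measures of a semiflow -/

/-- `μ` is a probability measure on `M`, invariant under `φ`. -/
def IsInvariantOn {n : ℕ} (φ : ℝ → Vec n → Vec n) (M : Set (Vec n)) (μ : Measure (Vec n)) : Prop :=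
  IsProbabilityMeasure μ ∧ μ Mᶜ = 0 ∧
  ∀ A ⊆ M, MeasurableSet A → ∀ t, 0 ≤ t → μ (φ t '' A) = μ A

/-- `μ` is an ergodic invariant probability measure on `M`. -/
def IsErgodicOn {n : ℕ} (φ : ℝ → Vec n → Vec n) (M : Set (Vec n)) (μ : Measure (Vec n)) : Prop :=
  IsInvariantOn φ M μ ∧
  ∀ A ⊆ M, MeasurableSet A → (∀ t, 0 ≤ t → φ t '' A ⊆ A) → μ A = 0 ∨ μ A = 1

/-- The support of `μ` in `M`. -/
def supportIn {n : ℕ} (M : Set (Vec n)) (μ : Measure (Vec n)) : Set (Vec n) :=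
  {x ∈ M | ∀ r, 0 < r → 0 < μ (Metric.closedBall x r)}

/-! ### Chain policies -/

/-- One verification triple: a center, a radius and a control snippet (a signal used on
`(0, duration]`). -/
structure Assignment (n m : ℕ) where
  center : Vec n
  radius : ℝ
  duration : ℝ
  control : ℝ → Vec m

namespace ChainPolicy

variable {n m N : ℕ} (K : Fin N → Assignment n m)

/-- The support of an assignment set. -/
def Supp : Set (Vec n) := ⋃ i, Metric.closedBall (K i).center (K i).radius

/-- Distance to the `i`-th center, normalized by the `i`-th radius. -/
noncomputable def normDist (x : Vec n) (i : Fin N) : ℝ := ‖x - (K i).center‖ / (K i).radius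

/-- `ι` is an index map on `X`: inside the support it selects an assignment of minimal normalized
distance (ties broken in any way), outside it selects the default control `none`. -/
def IsIndexMap (X : Set (Vec n)) (ι : Vec n → Option (Fin N)) : Prop :=
  ∀ x ∈ X,
    ((⨅ i, normDist K x i) ≤ 1 → ∃ i, ι x = some i ∧ normDist K x i = ⨅ j, normDist K x j) ∧
    (1 < (⨅ i, normDist K x i) → ι x = none)

/-- The duration of the selected snippet; the default snippet has duration `τ₀`. -/
def duration (τ₀ : ℝ) : Option (Fin N) → ℝ
  | none => τ₀
  | some i => (K i).duration

/-- The selected control; the default is the zero input. -/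
noncomputable def control : Option (Fin N) → ℝ → Vec m
  | none => fun _ => 0
  | some i => (K i).control

variable (S : HamiltonianSystem n m) (τ₀ : ℝ) (ι : Vec n → Option (Fin N)) (x₀ : Vec n)

/-- The state at the `k`-th decision instant when the policy is executed from `x₀`. -/
noncomputable def state : ℕ → Vec n
  | 0 => x₀
  | k + 1 => S.flow (duration K τ₀ (ι (state k))) (state k) (control K (ι (state k)))

/-- The `k`-th decision instant. -/
noncomputable def time (k : ℕ) : ℝ :=
  ∑ j ∈ Finset.range k, duration K τ₀ (ι (state K S τ₀ ι x₀ j))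

/-- The closed-loop trajectory from `x₀` is in `A` at time `t`. -/
def InAt (A : Set (Vec n)) (t : ℝ) : Prop :=
  ∃ k, time K S τ₀ ι x₀ k ≤ t ∧ t ≤ time K S τ₀ ι x₀ (k + 1) ∧
    S.flow (t - time K S τ₀ ι x₀ k) (state K S τ₀ ι x₀ k)
      (control K (ι (state K S τ₀ ι x₀ k))) ∈ A

end ChainPolicy

/-!
Along the certified snippets the energy distance `ΔH` decreases: by Grönwall's inequality an optimal
control of a center `x_i`, applied from a state within the radius `r_i`, still decreases `ΔH` by at
least `v₀ τ_i` (`IsRegular.DH_flow_le`). The zero input conserves `H`, because `J` is skew-symmetric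
(`H_zeroFlow`). As `ΔH` is bounded below, a chain policy executes only finitely many snippets and
applies the zero input from then on (`exists_forall_ge_eq_none`), so that the state stays on one
relevant energy layer.

On such a layer, ergodicity and full support make almost every zero-input trajectory visit any
open set that meets the layer (`IsRegular.measure_zeroFlow_notMem_eq_zero`). Inside the target band
that open set is the interior of the target. Outside it is the union of slightly shrunken balls of
the assignment set; a visit there would, for a short default duration, put a decision instant inside
the support and start another snippet. The exceptional states therefore form a Lebesgue null set,
and since the flow maps are injective with Lipschitz inverses, the initial states that are led into
it form a null set as well (`volume_state_preimage_eq_zero`).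

It remains to find few balls that meet every layer outside the open target band. All centers are
placed on the segment from the minimizer to the maximizer of `H`. There strong convexity gives
`|H p - H q| ≥ μH ‖p - q‖² / 2`, so that centers whose energies form a maximal
`μH ρ² / 2`-separated set suffice, where `ρ` is a common lower bound of the radii, and the number of
separated energies is bounded by the energy range of the support (`IsRegular.exists_energy_net`).
The bound is independent of the dimension because only energies, not states, have to be covered.
-/

/-! ### Trajectories and Grönwall estimates -/

/-- Grönwall's inequality in integral form. -/
theorem le_mul_exp_of_le_add_integral {d : ℝ → ℝ} {a L T : ℝ} (hd : Continuous d) (hL : 0 ≤ L)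
    (h : ∀ s ∈ Icc 0 T, d s ≤ a + L * ∫ τ in (0 : ℝ)..s, d τ) {s : ℝ} (hs : s ∈ Icc 0 T) :
    d s ≤ a * Real.exp (L * s) := by
  set g : ℝ → ℝ := fun s => ∫ τ in (0 : ℝ)..s, d τ with hg
  have hg' : ∀ s, HasDerivAt g (d s) s := fun s =>
    intervalIntegral.integral_hasDerivAt_right (hd.intervalIntegrable _ _)
      (hd.stronglyMeasurableAtFilter _ _) hd.continuousAt
  have hG : ∀ s, HasDerivAt (fun s => Real.exp (-(L * s)) * (a + L * g s))
      (Real.exp (-(L * s)) * (L * (d s - (a + L * g s)))) s := by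
    intro s
    have h1 : HasDerivAt (fun s => Real.exp (-(L * s))) (Real.exp (-(L * s)) * -(L * 1)) s :=
      (((hasDerivAt_id s).const_mul L).neg).exp
    have h2 := h1.mul (((hg' s).const_mul L).const_add a)
    exact h2.congr_deriv (by ring)
  have hanti : AntitoneOn (fun s => Real.exp (-(L * s)) * (a + L * g s)) (Icc 0 T) := by
    apply antitoneOn_of_deriv_nonpos (convex_Icc 0 T)
      (fun s _ => (hG s).continuousAt.continuousWithinAt)
      (fun s _ => (hG s).differentiableAt.differentiableWithinAt)
    intro s hs
    rw [interior_Icc] at hs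
    rw [(hG s).deriv]
    have := h s ⟨hs.1.le, hs.2.le⟩
    exact mul_nonpos_of_nonneg_of_nonpos (Real.exp_pos _).le
      (mul_nonpos_of_nonneg_of_nonpos hL (by simpa [hg] using this))
  have h0 := hanti ⟨le_rfl, hs.1.trans hs.2⟩ hs hs.1
  have hg0 : g 0 = 0 := by simp [hg]
  simp only [mul_zero, neg_zero, Real.exp_zero, one_mul, hg0, add_zero] at h0
  rw [Real.exp_neg, inv_mul_le_iff₀ (Real.exp_pos _)] at h0
  calc d s ≤ a + L * g s := h s hs
    _ ≤ _ := by linarith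

namespace HamiltonianSystem

variable {n m : ℕ} {S : HamiltonianSystem n m}

/-- A trajectory, continuous on `[0, ∞)`, extended to a continuous function on `ℝ`. -/
theorem IsTrajectory.continuous_max {x : Vec n} {u : ℝ → Vec m} {ξ : ℝ → Vec n}
    (hξ : S.IsTrajectory x u ξ) : Continuous fun s => ξ (max s 0) :=
  hξ.1.comp_continuous (by fun_prop) fun s => mem_Ici.2 (le_max_right s 0)

theorem IsTrajectory.norm_sub_sub_sub_le {L : ℝ} (hlip : S.LipschitzDynamics L)
    {x y : Vec n} {u : ℝ → Vec m} {ξ η : ℝ → Vec n} (hu : S.Admissible u)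
    (hξ : S.IsTrajectory x u ξ) (hη : S.IsTrajectory y u η) {a b : ℝ} (ha : 0 ≤ a) (hab : a ≤ b) :
    ‖(ξ b - η b) - (ξ a - η a)‖ ≤ L * ∫ s in a..b, ‖ξ (max s 0) - η (max s 0)‖ := by
  have hb := ha.trans hab
  obtain ⟨iξa, eξa⟩ := hξ.2.2 a ha
  obtain ⟨iξb, eξb⟩ := hξ.2.2 b hb
  obtain ⟨iηa, eηa⟩ := hη.2.2 a ha
  obtain ⟨iηb, eηb⟩ := hη.2.2 b hb
  have hcont : Continuous fun s => ‖ξ (max s 0) - η (max s 0)‖ :=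
    (hξ.continuous_max.sub hη.continuous_max).norm
  have e : (ξ b - η b) - (ξ a - η a) = ∫ s in a..b, (S.f (ξ s) (u s) - S.f (η s) (u s)) := by
    rw [intervalIntegral.integral_sub (iξa.symm.trans iξb) (iηa.symm.trans iηb),
      ← intervalIntegral.integral_interval_sub_left iξb iξa,
      ← intervalIntegral.integral_interval_sub_left iηb iηa, eξb, eξa, eηb, eηa]
    abel
  rw [e, ← intervalIntegral.integral_const_mul]
  refine intervalIntegral.norm_integral_le_of_norm_le hab (ae_of_all _ fun s hs => ?_)
    ((hcont.const_smul L).intervalIntegrable _ _)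
  have hs0 : 0 < s := ha.trans_lt hs.1
  rw [max_eq_left hs0.le]
  exact hlip _ (hu.1 s hs0) _ (hξ.2.1 s hs0.le) _ (hη.2.1 s hs0.le)

theorem IsTrajectory.apply_zero {x : Vec n} {u : ℝ → Vec m} {ξ : ℝ → Vec n}
    (hξ : S.IsTrajectory x u ξ) : ξ 0 = x := by
  simpa using (hξ.2.2 0 le_rfl).2

theorem IsTrajectory.norm_sub_le {L : ℝ} (hL : 0 ≤ L) (hlip : S.LipschitzDynamics L)
    {x y : Vec n} {u : ℝ → Vec m} {ξ η : ℝ → Vec n} (hu : S.Admissible u)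
    (hξ : S.IsTrajectory x u ξ) (hη : S.IsTrajectory y u η) {t : ℝ} (ht : 0 ≤ t) :
    ‖ξ t - η t‖ ≤ ‖x - y‖ * Real.exp (L * t) := by
  have key := le_mul_exp_of_le_add_integral (d := fun s => ‖ξ (max s 0) - η (max s 0)‖)
    (a := ‖x - y‖) (T := t) (hξ.continuous_max.sub hη.continuous_max).norm hL ?_ ⟨ht, le_rfl⟩
  · simpa [max_eq_left ht] using key
  · intro s hs
    have h := hξ.norm_sub_sub_sub_le hlip hu hη le_rfl hs.1
    rw [hξ.apply_zero, hη.apply_zero] at h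
    rw [max_eq_left hs.1]
    linarith [norm_le_norm_add_norm_sub' (ξ s - η s) (x - y)]

/-- Grönwall's inequality in reversed time: trajectories under the same control separate at most
exponentially in backward time, so the flow is injective with Lipschitz inverse. -/
theorem IsTrajectory.norm_initial_sub_le {L : ℝ} (hL : 0 ≤ L) (hlip : S.LipschitzDynamics L)
    {x y : Vec n} {u : ℝ → Vec m} {ξ η : ℝ → Vec n} (hu : S.Admissible u)
    (hξ : S.IsTrajectory x u ξ) (hη : S.IsTrajectory y u η) {t : ℝ} (ht : 0 ≤ t) :
    ‖x - y‖ ≤ ‖ξ t - η t‖ * Real.exp (L * t) := by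
  have key := le_mul_exp_of_le_add_integral
    (d := fun s => ‖ξ (max (t - s) 0) - η (max (t - s) 0)‖)
    (a := ‖ξ t - η t‖) (T := t)
    ((hξ.continuous_max.sub hη.continuous_max).norm.comp (continuous_const.sub continuous_id))
    hL ?_ ⟨ht, le_rfl⟩
  · simpa [hξ.apply_zero, hη.apply_zero] using key
  · intro s hs
    have hts : 0 ≤ t - s := by linarith [hs.2]
    have h := hξ.norm_sub_sub_sub_le hlip hu hη hts (by linarith [hs.1] : t - s ≤ t)
    rw [intervalIntegral.integral_comp_sub_left (fun s => ‖ξ (max s 0) - η (max s 0)‖) t, sub_zero]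
    rw [max_eq_left hts]
    have h2 := norm_le_norm_add_norm_sub' (ξ (t - s) - η (t - s)) (ξ t - η t)
    rw [norm_sub_rev (ξ (t - s) - η (t - s))] at h2
    linarith

theorem isTrajectory_flow (hfwd : S.ForwardComplete) {x : Vec n} (hx : x ∈ S.X) {u : ℝ → Vec m}
    (hu : S.Admissible u) : S.IsTrajectory x u (fun t => S.flow t x u) := by
  have h := hfwd x hx u hu
  have e : (fun t => S.flow t x u) = h.choose := by
    funext t
    simp only [flow, dif_pos h]
  rw [e]
  exact h.choose_spec

theorem flow_eq_of_isTrajectory {L : ℝ} (hL : 0 ≤ L) (hlip : S.LipschitzDynamics L)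
    (hfwd : S.ForwardComplete) {x : Vec n} (hx : x ∈ S.X) {u : ℝ → Vec m} {ξ : ℝ → Vec n}
    (hu : S.Admissible u) (hξ : S.IsTrajectory x u ξ) {t : ℝ} (ht : 0 ≤ t) :
    S.flow t x u = ξ t := by
  have h := (isTrajectory_flow hfwd hx hu).norm_sub_le hL hlip hu hξ ht
  simpa [sub_eq_zero] using h

theorem flow_mem (hfwd : S.ForwardComplete) {x : Vec n} (hx : x ∈ S.X) {u : ℝ → Vec m}
    (hu : S.Admissible u) {t : ℝ} (ht : 0 ≤ t) : S.flow t x u ∈ S.X :=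
  (isTrajectory_flow hfwd hx hu).2.1 t ht

/-! ### The zero-input flow -/

theorem admissible_zero (hU : (0 : Vec m) ∈ S.U) : S.Admissible (fun _ => 0) :=
  ⟨fun _ _ => hU, fun _ _ => ⟨⟨∅, finite_empty, continuousOn_const⟩,
    fun _ _ => ⟨0, tendsto_const_nhds⟩, fun _ _ => ⟨0, tendsto_const_nhds⟩⟩⟩

theorem zeroFlow_mem (hU : (0 : Vec m) ∈ S.U) (hfwd : S.ForwardComplete) {x : Vec n}
    (hx : x ∈ S.X) {t : ℝ} (ht : 0 ≤ t) : S.zeroFlow t x ∈ S.X :=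
  flow_mem hfwd hx (admissible_zero hU) ht

theorem zeroFlow_zero (hU : (0 : Vec m) ∈ S.U) (hfwd : S.ForwardComplete) {x : Vec n}
    (hx : x ∈ S.X) : S.zeroFlow 0 x = x :=
  (isTrajectory_flow hfwd hx (admissible_zero hU)).apply_zero

theorem zeroFlow_add {L : ℝ} (hL : 0 ≤ L) (hlip : S.LipschitzDynamics L) (hU : (0 : Vec m) ∈ S.U)
    (hfwd : S.ForwardComplete) {x : Vec n} (hx : x ∈ S.X) {s t : ℝ} (hs : 0 ≤ s) (ht : 0 ≤ t) :
    S.zeroFlow (s + t) x = S.zeroFlow t (S.zeroFlow s x) := by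
  have h := isTrajectory_flow hfwd hx (admissible_zero hU)
  have hshift : S.IsTrajectory (S.zeroFlow s x) (fun _ => 0)
      (fun t => S.flow (s + t) x (fun _ => 0)) := by
    refine ⟨?_, fun t ht => h.2.1 _ (by positivity), fun t ht => ?_⟩
    · exact h.1.comp (by fun_prop) (fun t (ht : 0 ≤ t) => add_nonneg hs ht)
    · obtain ⟨i1, e1⟩ := h.2.2 s hs
      obtain ⟨i2, e2⟩ := h.2.2 (s + t) (by positivity)
      have i3 := (i1.symm.trans i2).comp_add_left s
      simp only [sub_self, add_sub_cancel_left] at i3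
      refine ⟨i3, ?_⟩
      rw [intervalIntegral.integral_comp_add_left
        (fun τ => S.f (S.flow τ x (fun _ => 0)) 0) s, add_zero,
        ← intervalIntegral.integral_interval_sub_left i2 i1]
      have e1' : S.zeroFlow s x = _ := e1
      rw [e1', e2]
      abel
  exact (flow_eq_of_isTrajectory hL hlip hfwd (h.2.1 s hs) (admissible_zero hU) hshift ht).symm

theorem exists_norm_f_le {L : ℝ} (hL : 0 ≤ L) (hlip : S.LipschitzDynamics L) {u : Vec m}
    (hu : u ∈ S.U) : ∃ M, 0 < M ∧ ∀ x ∈ S.X, ‖S.f x u‖ ≤ M := by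
  rcases S.X.eq_empty_or_nonempty with h | ⟨y, hy⟩
  · exact ⟨1, one_pos, by simp [h]⟩
  · refine ⟨‖S.f y u‖ + L * Metric.diam S.X + 1, by positivity, fun x hx => ?_⟩
    have h1 := hlip u hu x hx y hy
    have h2 : ‖x - y‖ ≤ Metric.diam S.X := by
      rw [← dist_eq_norm]
      exact Metric.dist_le_diam_of_mem S.isCompact_X.isBounded hx hy
    have h3 := norm_le_norm_add_norm_sub' (S.f x u) (S.f y u)
    have h4 := mul_le_mul_of_nonneg_left h2 hL
    linarith

theorem norm_zeroFlow_sub_le {M : ℝ} (hU : (0 : Vec m) ∈ S.U) (hfwd : S.ForwardComplete)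
    (hM : ∀ x ∈ S.X, ‖S.f x 0‖ ≤ M) {x : Vec n} (hx : x ∈ S.X) {s t : ℝ} (hs : 0 ≤ s)
    (hst : s ≤ t) : ‖S.zeroFlow t x - S.zeroFlow s x‖ ≤ M * (t - s) := by
  have h := isTrajectory_flow hfwd hx (admissible_zero hU)
  obtain ⟨i1, e1⟩ := h.2.2 s hs
  obtain ⟨i2, e2⟩ := h.2.2 t (hs.trans hst)
  have e : S.zeroFlow t x - S.zeroFlow s x
      = ∫ τ in s..t, S.f (S.flow τ x (fun _ => 0)) 0 := by
    have e1' : S.zeroFlow s x = _ := e1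
    have e2' : S.zeroFlow t x = _ := e2
    rw [← intervalIntegral.integral_interval_sub_left i2 i1, e1', e2']
    abel
  rw [e]
  have := intervalIntegral.norm_integral_le_of_norm_le_const (a := s) (b := t) (C := M)
    (f := fun τ => S.f (S.flow τ x (fun _ => 0)) 0) ?_
  · rwa [abs_of_nonneg (sub_nonneg.2 hst)] at this
  · intro τ hτ
    rw [uIoc_of_le hst] at hτ
    exact hM _ (h.2.1 τ (hs.trans hτ.1.le))

theorem inner_gradient_f_zero {x : Vec n} (hx : x ∈ S.X) :
    inner ℝ (gradient S.H x) (S.f x 0) = 0 := by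
  set g := (gradient S.H x).ofLp with hg
  have h1 : inner ℝ (gradient S.H x) (S.f x 0) = g ⬝ᵥ (S.J x *ᵥ g) := by
    rw [EuclideanSpace.inner_eq_star_dotProduct, dotProduct_comm]
    simp [f, hg]
  have h2 : g ⬝ᵥ (S.J x *ᵥ g) = -(g ⬝ᵥ (S.J x *ᵥ g)) := by
    conv_lhs => rw [Matrix.dotProduct_mulVec, ← Matrix.mulVec_transpose, S.skew x hx,
      Matrix.neg_mulVec, neg_dotProduct, dotProduct_comm]
  rw [h1]
  linarith

/-- Skew-symmetry of `J` makes the energy a constant of motion of the zero-input flow. -/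
theorem H_zeroFlow {L LH : ℝ} (hL : 0 ≤ L) (hlip : S.LipschitzDynamics L)
    (hU : (0 : Vec m) ∈ S.U) (hfwd : S.ForwardComplete) (hgrad : S.BoundedGradient LH)
    {x : Vec n} (hx : x ∈ S.X) {t : ℝ} (ht : 0 ≤ t) : S.H (S.zeroFlow t x) = S.H x := by
  have h := isTrajectory_flow hfwd hx (admissible_zero hU)
  set ξ : ℝ → Vec n := fun t => S.flow t x (fun _ => 0) with hξ
  have hfc : ContinuousOn (fun y => S.f y 0) S.X := by
    apply LipschitzOnWith.continuousOn (K := L.toNNReal)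
    apply LipschitzOnWith.of_dist_le_mul
    intro a ha b hb
    rw [dist_eq_norm, dist_eq_norm, Real.coe_toNNReal L hL]
    exact hlip 0 hU a ha b hb
  have hc : Continuous fun s => S.f (ξ (max s 0)) 0 :=
    hfc.comp_continuous h.continuous_max fun s => h.2.1 _ (le_max_right _ _)
  have hder : ∀ s ∈ Ico 0 t, HasDerivWithinAt ξ (S.f (ξ s) 0) (Ici s) s := by
    intro s hs
    have h1 : HasDerivAt (fun τ => x + ∫ r in (0 : ℝ)..τ, S.f (ξ (max r 0)) 0)
        (S.f (ξ (max s 0)) 0) s :=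
      (intervalIntegral.integral_hasDerivAt_right (hc.intervalIntegrable _ _)
        (hc.stronglyMeasurableAtFilter _ _) hc.continuousAt).const_add x
    rw [max_eq_left hs.1] at h1
    have heq : ∀ τ ∈ Ici s, ξ τ = x + ∫ r in (0 : ℝ)..τ, S.f (ξ (max r 0)) 0 := by
      intro τ hτ
      have hτ0 : 0 ≤ τ := hs.1.trans hτ
      rw [(h.2.2 τ hτ0).2]
      congr 1
      refine intervalIntegral.integral_congr fun r hr => ?_
      rw [uIcc_of_le hτ0] at hr
      simp only [max_eq_left hr.1, hξ]
    exact h1.hasDerivWithinAt.congr heq (heq s self_mem_Ici)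
  have hH : ∀ s ∈ Ico 0 t, HasDerivWithinAt (fun s => S.H (ξ s)) 0 (Ici s) s := by
    intro s hs
    have h1 := (hgrad.1 (ξ s) (h.2.1 s hs.1)).hasGradientAt.hasFDerivAt
    have h2 := h1.comp_hasDerivWithinAt s (hder s hs)
    refine h2.congr_deriv ?_
    rw [InnerProductSpace.toDual_apply_apply, inner_gradient_f_zero (h.2.1 s hs.1)]
  have hcont : ContinuousOn (fun s => S.H (ξ s)) (Icc 0 t) := by
    intro s hs
    exact (hgrad.1 (ξ s) (h.2.1 s hs.1)).continuousAt.comp_continuousWithinAt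
      ((h.1 s hs.1).mono Icc_subset_Ici_self)
  have := constant_of_has_deriv_right_zero hcont hH t ⟨ht, le_rfl⟩
  rw [h.apply_zero] at this
  exact this

/-! ### Null sets -/

/-- The flow map is injective with Lipschitz inverse, so it pulls null sets back to null sets. -/
theorem volume_flow_preimage_eq_zero {L : ℝ} (hL : 0 ≤ L) (hlip : S.LipschitzDynamics L)
    (hfwd : S.ForwardComplete) {u : ℝ → Vec m} (hu : S.Admissible u) {t : ℝ} (ht : 0 ≤ t)
    {B : Set (Vec n)} (hB : volume B = 0) : volume {x ∈ S.X | S.flow t x u ∈ B} = 0 := by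
  set A := {x ∈ S.X | S.flow t x u ∈ B} with hA
  have hanti : AntilipschitzWith (Real.exp (L * t)).toNNReal
      (fun x : A => S.flow t x u) := by
    apply AntilipschitzWith.of_le_mul_dist
    intro x y
    rw [Subtype.dist_eq, dist_eq_norm, dist_eq_norm, Real.coe_toNNReal _ (Real.exp_pos _).le,
      mul_comm]
    exact (isTrajectory_flow hfwd x.2.1 hu).norm_initial_sub_le hL hlip hu
      (isTrajectory_flow hfwd y.2.1 hu) ht
  have h1 : volume ≪ Measure.hausdorffMeasure (X := Vec n) (Module.finrank ℝ (Vec n)) :=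
    Measure.absolutelyContinuous_isAddHaarMeasure _ _
  have h2 : Measure.hausdorffMeasure (X := Vec n) (Module.finrank ℝ (Vec n)) ≪ volume :=
    Measure.absolutelyContinuous_isAddHaarMeasure _ _
  apply h1
  have h3 := hanti.hausdorffMeasure_preimage_le (d := Module.finrank ℝ (Vec n))
    (Nat.cast_nonneg _) B
  rw [h2 hB, mul_zero, nonpos_iff_eq_zero] at h3
  have h4 : (fun x : A => S.flow t x u) ⁻¹' B = univ := eq_univ_of_forall fun x => x.2.2
  rw [h4] at h3
  have h5 := isometry_subtype_coe (s := A) |>.hausdorffMeasure_image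
    (d := Module.finrank ℝ (Vec n)) (Or.inl (Nat.cast_nonneg _)) univ
  rwa [image_univ, Subtype.range_coe, h3] at h5

end HamiltonianSystem

namespace HamiltonianSystem

variable {n m : ℕ} {S : HamiltonianSystem n m}

/-- The regularity assumptions on the dynamics and the energy: convex state set, admissible zero
input, energy gradient bounded by `LH`, `L`-Lipschitz dynamics, and forward completeness. -/
structure IsRegular (S : HamiltonianSystem n m) (L LH : ℝ) : Prop where
  convex : Convex ℝ S.X
  zero_mem : (0 : Vec m) ∈ S.U
  LH_pos : 0 < LH
  grad : S.BoundedGradient LH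
  L_pos : 0 < L
  lip : S.LipschitzDynamics L
  fwd : S.ForwardComplete

variable {L LH ε v₀ : ℝ} {Stgt : Set (Vec n)}

/-! ### Energy and energy distance -/

theorem BoundedGradient.continuousOn (hgrad : S.BoundedGradient LH) : ContinuousOn S.H S.X :=
  fun x hx => (hgrad.1 x hx).continuousAt.continuousWithinAt

theorem continuous_levelDist : Continuous (S.levelDist Stgt) := by
  unfold levelDist
  fun_prop

theorem BoundedGradient.continuousOn_DH (hgrad : S.BoundedGradient LH) :
    ContinuousOn (S.DH Stgt) S.X :=
  continuous_levelDist.comp_continuousOn hgrad.continuousOn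

theorem abs_levelDist_sub_le (E E' : ℝ) :
    |S.levelDist Stgt E - S.levelDist Stgt E'| ≤ |E - E'| := by
  have h := abs_abs_sub_abs_le_abs_sub (E - S.Hplus Stgt) (E' - S.Hplus Stgt)
  simpa [levelDist] using h

theorem IsRegular.abs_H_sub_le (hS : S.IsRegular L LH) {x y : Vec n} (hx : x ∈ S.X)
    (hy : y ∈ S.X) : |S.H x - S.H y| ≤ LH * ‖x - y‖ := by
  rw [← Real.norm_eq_abs]
  refine hS.convex.norm_image_sub_le_of_norm_hasFDerivWithin_le
    (f' := fun z => InnerProductSpace.toDual ℝ (Vec n) (gradient S.H z))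
    (fun z hz => (hS.grad.1 z hz).hasGradientAt.hasFDerivAt.hasFDerivWithinAt) ?_ hy hx
  intro z hz
  rw [LinearIsometryEquiv.norm_map]
  exact hS.grad.2.2 z hz

theorem IsRegular.DH_le_add (hS : S.IsRegular L LH) {x y : Vec n} (hx : x ∈ S.X)
    (hy : y ∈ S.X) : S.DH Stgt x ≤ S.DH Stgt y + LH * ‖x - y‖ := by
  have h := (abs_levelDist_sub_le (S := S) (Stgt := Stgt) (S.H x) (S.H y)).trans (hS.abs_H_sub_le hx hy)
  have := (abs_le.1 h).2
  unfold DH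
  linarith

theorem isClosed_Htgt (hgrad : S.BoundedGradient LH) : IsClosed (S.Htgt Stgt ε) :=
  hgrad.continuousOn_DH.preimage_isClosed_of_isClosed S.isCompact_X.isClosed isClosed_Iic

theorem neg_lt_DH {x : Vec n} (hx : x ∈ S.X \ S.Htgt Stgt ε) : -ε < S.DH Stgt x := by
  by_contra! h
  exact hx.2 ⟨hx.1, h⟩

/-! ### Hitting times and decrease rates -/

/-- A finite hitting time is positive and attained; the trajectory is outside the shrunken band
before and on its boundary at the hitting time. -/
theorem IsRegular.hitTime_spec (hS : S.IsRegular L LH) {x : Vec n}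
    (hx : x ∈ S.X \ S.Htgt Stgt ε) {u : ℝ → Vec m} (hu : S.Admissible u)
    (hfin : S.hitTime Stgt ε x u ≠ ⊤) :
    0 < (S.hitTime Stgt ε x u).toReal ∧
    S.flow (S.hitTime Stgt ε x u).toReal x u ∈ frontier (S.Htgt Stgt ε) ∧
    S.DH Stgt (S.flow (S.hitTime Stgt ε x u).toReal x u) = -ε := by
  have htraj := isTrajectory_flow hS.fwd hx.1 hu
  set A : Set ℝ := {t ∈ Ici (0 : ℝ) | S.flow t x u ∈ S.Htgt Stgt ε} with hA
  have hcl := isClosed_Htgt (Stgt := Stgt) (ε := ε) hS.grad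
  have hAcl : IsClosed A := htraj.1.preimage_isClosed_of_isClosed isClosed_Ici hcl
  have hAne : A.Nonempty := by
    by_contra h
    apply hfin
    rw [hitTime, iInf_eq_top]
    rintro ⟨t, ht, ht'⟩
    exact absurd ⟨t, ht.le, ht'⟩ h
  have hAbdd : BddBelow A := ⟨0, fun t ht => ht.1⟩
  set T := sInf A with hT
  have hTA : T ∈ A := hAcl.csInf_mem hAne hAbdd
  have hT0 : 0 < T := by
    refine lt_of_le_of_ne hTA.1 fun h => hx.2 ?_
    have h2 := hTA.2
    rw [← h] at h2
    have h3 : S.flow 0 x u = x := htraj.apply_zero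
    rwa [h3] at h2
  have hhit : S.hitTime Stgt ε x u = ENNReal.ofReal T := by
    apply le_antisymm
    · exact iInf_le (fun t : {t : ℝ // 0 < t ∧ S.flow t x u ∈ S.Htgt Stgt ε} =>
        ENNReal.ofReal t) ⟨T, hT0, hTA.2⟩
    · refine le_iInf fun t => ENNReal.ofReal_le_ofReal (csInf_le hAbdd ⟨t.2.1.le, t.2.2⟩)
  rw [hhit, ENNReal.toReal_ofReal hT0.le]
  have hbefore : ∀ t ∈ Ico 0 T, S.flow t x u ∉ S.Htgt Stgt ε := fun t ht h =>
    absurd (csInf_le hAbdd ⟨ht.1, h⟩) (not_le.2 ht.2)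
  have hcw : ContinuousWithinAt (fun t => S.flow t x u) (Ico 0 T) T :=
    (htraj.1 T hT0.le).mono fun t ht => ht.1
  have hTcl : T ∈ closure (Ico 0 T) := by
    rw [closure_Ico hT0.ne]
    exact ⟨hT0.le, le_rfl⟩
  refine ⟨hT0, ?_, le_antisymm hTA.2.2 ?_⟩
  · rw [frontier_eq_closure_inter_closure]
    exact ⟨subset_closure hTA.2, hcw.mem_closure hTcl hbefore⟩
  · have hcw' : ContinuousWithinAt (fun t => S.DH Stgt (S.flow t x u)) (Ico 0 T) T :=
      ContinuousWithinAt.comp (g := S.DH Stgt) (t := S.X) (hS.grad.continuousOn_DH _ hTA.2.1) hcw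
        fun t ht => htraj.2.1 t ht.1
    have := hcw'.mem_closure (t := Ici (-ε)) hTcl fun t ht =>
      (neg_lt_DH ⟨htraj.2.1 t ht.1, hbefore t ht⟩).le
    rwa [isClosed_Ici.closure_eq] at this

theorem optHitTime_ne_top (hreach : S.TargetBandReachable Stgt ε) {x : Vec n}
    (hx : x ∈ S.X \ S.Htgt Stgt ε) : S.optHitTime Stgt ε x ≠ ⊤ := by
  obtain ⟨T, hT, u, hu, h⟩ := hreach x hx
  refine ne_top_of_le_ne_top (ENNReal.ofReal_ne_top (r := T)) ?_
  exact (iInf_le (fun u : {u : ℝ → Vec m // S.Admissible u} => S.hitTime Stgt ε x u)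
    ⟨u, hu⟩).trans (iInf_le (fun t : {t : ℝ // 0 < t ∧ S.flow t x u ∈ S.Htgt Stgt ε} =>
        ENNReal.ofReal t) ⟨T, hT, h⟩)

theorem IsOptimalControl.toReal_hitTime {x : Vec n} {u : ℝ → Vec m}
    (hu : S.IsOptimalControl Stgt ε x u) :
    (S.hitTime Stgt ε x u).toReal = S.optTime Stgt ε x := by
  rw [hu.2, optTime]

/-- Along every control the energy distance drops from `ΔH(x)` to `-ε` up to the hitting time, so
the best rate is the one of the shortest hitting time. -/
theorem IsRegular.bestRate_mul_optTime (hS : S.IsRegular L LH)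
    (hreach : S.TargetBandReachable Stgt ε) {x : Vec n} (hx : x ∈ S.X \ S.Htgt Stgt ε)
    {u : ℝ → Vec m} (hu : S.IsOptimalControl Stgt ε x u) :
    0 < S.optTime Stgt ε x ∧ S.bestRate Stgt ε x * S.optTime Stgt ε x = S.DH Stgt x + ε := by
  have hfin := optHitTime_ne_top hreach hx
  have hspec := hS.hitTime_spec hx hu.1 (hu.2 ▸ hfin)
  have hrate : ∀ w, S.Admissible w → S.hitTime Stgt ε x w ≠ ⊤ →
      S.rateAlong Stgt ε x w = (S.DH Stgt x + ε) / (S.hitTime Stgt ε x w).toReal := by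
    intro w hw hwfin
    rw [rateAlong, (hS.hitTime_spec hx hw hwfin).2.2, sub_neg_eq_add]
  have hT : 0 < S.optTime Stgt ε x := hu.toReal_hitTime ▸ hspec.1
  refine ⟨hT, ?_⟩
  have hbest : S.bestRate Stgt ε x = (S.DH Stgt x + ε) / S.optTime Stgt ε x := by
    refine IsGreatest.csSup_eq ⟨⟨u, hu.1, hu.2 ▸ hfin, ?_⟩, ?_⟩
    · rw [hrate u hu.1 (hu.2 ▸ hfin), hu.toReal_hitTime]
    · rintro v ⟨w, hw, hwfin, rfl⟩
      rw [hrate w hw hwfin]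
      refine div_le_div_of_nonneg_left (by linarith [neg_lt_DH hx]) hT ?_
      exact ENNReal.toReal_mono hwfin (iInf_le
        (fun u : {u : ℝ → Vec m // S.Admissible u} => S.hitTime Stgt ε x u) ⟨w, hw⟩)
  rw [hbest, div_mul_cancel₀ _ hT.ne']

theorem IsRegular.minRate_le (hS : S.IsRegular L LH) (hreach : S.TargetBandReachable Stgt ε)
    (hopt : ∀ x ∈ S.X \ S.Htgt Stgt ε, ∃ u, S.IsOptimalControl Stgt ε x u) {x : Vec n}
    (hx : x ∈ S.X \ S.Htgt Stgt ε) : S.minRate Stgt ε ≤ S.bestRate Stgt ε x := by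
  refine csInf_le ⟨0, ?_⟩ (mem_image_of_mem _ hx)
  rintro _ ⟨y, hy, rfl⟩
  obtain ⟨u, hu⟩ := hopt y hy
  obtain ⟨h1, h2⟩ := hS.bestRate_mul_optTime hreach hy hu
  refine (pos_of_mul_pos_left ?_ h1.le).le
  rw [h2]
  linarith [neg_lt_DH hy]

/-- The certified radius is chosen so that an optimal control of the center `c`, applied from any
state of the ball around `c`, decreases the energy distance at the certified rate `v₀`. -/
theorem IsRegular.DH_flow_le (hS : S.IsRegular L LH) (hreach : S.TargetBandReachable Stgt ε)
    {c : Vec n} (hc : c ∈ S.X \ S.Htgt Stgt ε) {u : ℝ → Vec m}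
    (hu : S.IsOptimalControl Stgt ε c u) {x : Vec n} (hx : x ∈ S.X)
    (hxc : ‖x - c‖ ≤ S.certRadius Stgt L LH ε v₀ c) :
    S.DH Stgt (S.flow (S.optTime Stgt ε c) x u) ≤ S.DH Stgt x - v₀ * S.optTime Stgt ε c := by
  obtain ⟨hT, hv⟩ := hS.bestRate_mul_optTime hreach hc hu
  set T := S.optTime Stgt ε c with hTdef
  have hend : S.DH Stgt (S.flow T c u) = -ε := by
    rw [hTdef, ← hu.toReal_hitTime]
    exact (hS.hitTime_spec hc hu.1 (hu.2 ▸ optHitTime_ne_top hreach hc)).2.2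
  have hden : 0 < LH * (1 + Real.exp (L * T)) := mul_pos hS.LH_pos (by positivity)
  have hr : S.certRadius Stgt L LH ε v₀ c * (LH * (1 + Real.exp (L * T)))
      = (S.bestRate Stgt ε c - v₀) * T := div_mul_cancel₀ _ hden.ne'
  have h1 := hS.DH_le_add (Stgt := Stgt) (flow_mem hS.fwd hx hu.1 hT.le)
    (flow_mem hS.fwd hc.1 hu.1 hT.le)
  have h2 := hS.DH_le_add (Stgt := Stgt) hc.1 hx
  have h3 := (isTrajectory_flow hS.fwd hx hu.1).norm_sub_le hS.L_pos.le hS.lip hu.1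
    (isTrajectory_flow hS.fwd hc.1 hu.1) hT.le
  rw [norm_sub_rev] at h2
  have h4 := mul_le_mul_of_nonneg_left h3 hS.LH_pos.le
  have h5 := mul_le_mul_of_nonneg_right hxc hden.le
  have h6 : LH * (‖x - c‖ * Real.exp (L * T)) + LH * ‖x - c‖
      = ‖x - c‖ * (LH * (1 + Real.exp (L * T))) := by ring
  linarith

/-! ### Bounds on certified radii -/

/-- A lower bound for the certified radii of the centers with nonnegative energy distance. -/
noncomputable def radiusBound (S : HamiltonianSystem n m) (Stgt : Set (Vec n)) (L LH ε v₀ : ℝ) :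
    ℝ :=
  (1 - v₀ / S.minRate Stgt ε) * ε /
    (2 * LH * Real.exp (L * (LH * Metric.diam S.X + ε) / S.minRate Stgt ε))

/-- The optimal time is at most `(LH · diam X + ε) / minRate`, and `1 + exp (L T) < 2 exp (L T)`
makes the bound strict; the strictness leaves room for the default snippet. -/
theorem IsRegular.radiusBound_lt_certRadius (hS : S.IsRegular L LH)
    (hreach : S.TargetBandReachable Stgt ε)
    (hopt : ∀ x ∈ S.X \ S.Htgt Stgt ε, ∃ u, S.IsOptimalControl Stgt ε x u)
    (hε : 0 < ε) (hv₀ : 0 < v₀) (hv : v₀ < S.minRate Stgt ε) {x y : Vec n}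
    (hx : x ∈ S.X \ S.Htgt Stgt ε) (hx0 : 0 ≤ S.DH Stgt x) (hy : y ∈ S.X)
    (hy0 : S.DH Stgt y ≤ 0) :
    radiusBound S Stgt L LH ε v₀ < S.certRadius Stgt L LH ε v₀ x := by
  obtain ⟨u, hu⟩ := hopt x hx
  obtain ⟨hT, hvT⟩ := hS.bestRate_mul_optTime hreach hx hu
  have hr := hS.minRate_le hreach hopt hx
  set T := S.optTime Stgt ε x with hTdef
  set v := S.minRate Stgt ε with hvdef
  have hvpos : 0 < v := hv₀.trans hv
  have hq : 0 < 1 - v₀ / v := by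
    rw [sub_pos, div_lt_one hvpos]
    exact hv
  have hdiam : S.DH Stgt x ≤ LH * Metric.diam S.X := by
    have h1 := hS.DH_le_add (Stgt := Stgt) hx.1 hy
    have h2 : ‖x - y‖ ≤ Metric.diam S.X := by
      rw [← dist_eq_norm]
      exact Metric.dist_le_diam_of_mem S.isCompact_X.isBounded hx.1 hy
    have h3 := mul_le_mul_of_nonneg_left h2 hS.LH_pos.le
    linarith
  have hTle : T ≤ (LH * Metric.diam S.X + ε) / v := by
    rw [le_div_iff₀ hvpos, mul_comm]
    have := mul_le_mul_of_nonneg_right hr hT.le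
    linarith
  have hexp : Real.exp (L * T) ≤ Real.exp (L * (LH * Metric.diam S.X + ε) / v) := by
    rw [Real.exp_le_exp, mul_div_assoc]
    exact mul_le_mul_of_nonneg_left hTle hS.L_pos.le
  have hexp1 : 1 < Real.exp (L * T) := Real.one_lt_exp_iff.2 (mul_pos hS.L_pos hT)
  have hnum : (1 - v₀ / v) * ε ≤ (S.bestRate Stgt ε x - v₀) * T := by
    have h1 : v₀ / v * (S.bestRate Stgt ε x * T) ≥ v₀ * T := by
      have : v₀ / v * (v * T) = v₀ * T := by field_simp
      rw [← this]
      have h0 : 0 ≤ v₀ / v := (div_pos hv₀ hvpos).le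
      gcongr
    have h2 : (1 - v₀ / v) * ε ≤ (1 - v₀ / v) * (S.bestRate Stgt ε x * T) :=
      mul_le_mul_of_nonneg_left (by linarith) hq.le
    linarith
  refine div_lt_div₀' hnum ?_ ((mul_pos hq hε).trans_le hnum) (mul_pos hS.LH_pos (by positivity))
  rw [mul_comm 2 LH, mul_assoc]
  exact mul_lt_mul_of_pos_left (by linarith) hS.LH_pos

end HamiltonianSystem

/-! ### Separated sets of reals -/

/-- A nonempty `δ`-separated finite set of reals with `N` elements has diameter at least
`(N - 1) δ`. -/
theorem Finset.exists_card_sub_one_mul_le_sub {δ : ℝ} (F : Finset ℝ) (hF : F.Nonempty)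
    (hsep : ∀ a ∈ F, ∀ b ∈ F, a < b → δ ≤ b - a) :
    ∃ a ∈ F, ∃ b ∈ F, (F.card - 1 : ℝ) * δ ≤ b - a := by
  induction F using Finset.induction_on_max with
  | empty => exact absurd hF (by simp)
  | insert m F hm ih =>
    have hmF : m ∉ F := fun h => lt_irrefl _ (hm m h)
    rw [Finset.card_insert_of_notMem hmF]
    rcases F.eq_empty_or_nonempty with rfl | hne
    · exact ⟨m, by simp, m, by simp, by simp⟩
    · obtain ⟨a, ha, b, hb, hab⟩ := ih hne fun a ha b hb =>
        hsep a (Finset.mem_insert_of_mem ha) b (Finset.mem_insert_of_mem hb)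
      refine ⟨a, Finset.mem_insert_of_mem ha, m, Finset.mem_insert_self _ _, ?_⟩
      have := hsep b (Finset.mem_insert_of_mem hb) m (Finset.mem_insert_self _ _) (hm b hb)
      push_cast
      linarith

/-- A maximal `δ`-separated subset of a bounded set of reals is finite, and every point of the set
is at distance less than `δ` from it. -/
theorem exists_finset_separated_cover {δ lo hi : ℝ} (hδ : 0 < δ) {C : Set ℝ} (hC : C ⊆ Icc lo hi)
    (hne : C.Nonempty) :
    ∃ F : Finset ℝ, F.Nonempty ∧ ↑F ⊆ C ∧ (∀ a ∈ F, ∀ b ∈ F, a < b → δ ≤ b - a) ∧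
      ∀ x ∈ C, ∃ a ∈ F, |x - a| < δ := by
  let P : ℕ → Prop := fun k => ∃ F : Finset ℝ, F.Nonempty ∧ ↑F ⊆ C ∧
    (∀ a ∈ F, ∀ b ∈ F, a < b → δ ≤ b - a) ∧ F.card = k
  obtain ⟨x₀, hx₀⟩ := hne
  have hP1 : P 1 := ⟨{x₀}, by simp, by simpa using hx₀, by
    simp only [Finset.mem_singleton]
    rintro a rfl b rfl h
    exact absurd h (lt_irrefl _), by simp⟩
  have hbound : ∀ k, P k → k ≤ ⌈(hi - lo) / δ + 1⌉₊ := by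
    rintro k ⟨F, hFne, hFC, hsep, rfl⟩
    obtain ⟨a, ha, b, hb, hab⟩ := F.exists_card_sub_one_mul_le_sub hFne hsep
    have h1 := (hC (hFC ha)).1
    have h2 := (hC (hFC hb)).2
    have h3 : (F.card : ℝ) ≤ (hi - lo) / δ + 1 := by
      rw [← sub_le_iff_le_add, le_div_iff₀ hδ]
      linarith
    exact_mod_cast h3.trans (Nat.le_ceil _)
  classical
  obtain ⟨F, hFne, hFC, hsep, hcard⟩ := Nat.findGreatest_spec (hbound 1 hP1) hP1
  refine ⟨F, hFne, hFC, hsep, fun x hx => ?_⟩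
  by_contra! hfar
  have hxF : x ∉ F := fun h => by
    have := hfar x h
    simp only [sub_self, abs_zero] at this
    linarith
  have hP : P (F.card + 1) := by
    -- adding a point far from `F` would give a larger separated set
    refine ⟨insert x F, by simp, ?_, ?_, Finset.card_insert_of_notMem hxF⟩
    · rw [Finset.coe_insert]
      exact insert_subset hx hFC
    · intro a ha b hb hab
      rcases Finset.mem_insert.1 ha with ha' | ha' <;>
        rcases Finset.mem_insert.1 hb with hb' | hb'
      · exact absurd (ha'.trans hb'.symm) hab.ne
      · have := hfar b hb'
        rwa [← ha', abs_sub_comm, abs_of_pos (sub_pos.2 hab)] at this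
      · have := hfar a ha'
        rwa [← hb', abs_of_pos (sub_pos.2 hab)] at this
      · exact hsep a ha' b hb' hab
  have := Nat.le_findGreatest (hbound _ hP) hP
  omega

namespace HamiltonianSystem

variable {n m : ℕ} {S : HamiltonianSystem n m} {L LH μH ε v₀ : ℝ} {Stgt : Set (Vec n)}

/-! ### The energy along a segment from its minimizer to its maximizer -/

/-- The energy does not decrease along a segment starting at its minimizer `z`. At `z` itself this
is the first-order optimality condition; elsewhere it follows from the strong convexity inequality
with second point `z`. -/
theorem IsRegular.inner_gradient_nonneg (hS : S.IsRegular L LH) {z w : Vec n} (hz : z ∈ S.X)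
    (hw : w ∈ S.X) (hmin : ∀ x ∈ S.X, S.H z ≤ S.H x) (hμH : 0 < μH)
    (hconv : S.StronglyConvexEnergy μH) {s : ℝ} (hs : 0 ≤ s) (hs1 : s ≤ 1) :
    0 ≤ inner ℝ (gradient S.H (z + s • (w - z))) (w - z) := by
  rcases hs.eq_or_lt with rfl | hs
  · have h1 := ((hS.grad.1 z hz).hasGradientAt.hasFDerivAt).hasFDerivWithinAt (s := S.X)
    have h2 := IsLocalMinOn.hasFDerivWithinAt_nonneg (f := S.H) (s := S.X) (a := z)
      ((isMinOn_iff.2 hmin).localize) h1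
      (sub_mem_posTangentConeAt_of_segment_subset (hS.convex.segment_subset hz hw))
    simpa using h2
  · have hp : z + s • (w - z) ∈ S.X := hS.convex.add_smul_sub_mem hz hw ⟨hs.le, hs1⟩
    have h := hconv _ hp z hz
    have h1 := hmin _ hp
    rw [show z - (z + s • (w - z)) = -(s • (w - z)) by abel, inner_neg_right,
      real_inner_smul_right] at h
    have h2 : 0 ≤ μH / 2 * ‖-(s • (w - z))‖ ^ 2 := by positivity
    exact nonneg_of_mul_nonneg_right (by linarith) hs


/-- Moving away from the minimizer along a segment, a strongly convex energy grows at least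
quadratically: the gradient term of the strong convexity inequality is nonnegative. -/
theorem IsRegular.le_abs_H_sub_segment (hS : S.IsRegular L LH) {z w : Vec n} (hz : z ∈ S.X)
    (hw : w ∈ S.X) (hmin : ∀ x ∈ S.X, S.H z ≤ S.H x) (hμH : 0 < μH)
    (hconv : S.StronglyConvexEnergy μH) {s t : ℝ} (hs : s ∈ Icc (0 : ℝ) 1)
    (ht : t ∈ Icc (0 : ℝ) 1) :
    μH / 2 * ‖(z + s • (w - z)) - (z + t • (w - z))‖ ^ 2
      ≤ |S.H (z + s • (w - z)) - S.H (z + t • (w - z))| := by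
  wlog hst : s ≤ t generalizing s t
  · rw [norm_sub_rev, abs_sub_comm]
    exact this ht hs (le_of_not_ge hst)
  have h := hconv _ (hS.convex.add_smul_sub_mem hz hw hs) _ (hS.convex.add_smul_sub_mem hz hw ht)
  have h1 := hS.inner_gradient_nonneg hz hw hmin hμH hconv hs.1 hs.2
  have h2 : z + t • (w - z) - (z + s • (w - z)) = (t - s) • (w - z) := by
    rw [sub_smul]
    abel
  rw [norm_sub_rev, abs_sub_comm]
  refine le_trans ?_ (le_abs_self _)
  rw [h2, real_inner_smul_right] at h
  rw [h2]
  have := mul_nonneg (sub_nonneg.2 hst) h1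
  linarith

theorem Hmin_mem_image (hgrad : S.BoundedGradient LH) (hStgt : IsCompact Stgt)
    (hne : Stgt.Nonempty) (hStgtX : Stgt ⊆ S.X) : S.Hmin Stgt ∈ S.H '' Stgt :=
  (hStgt.image_of_continuousOn (hgrad.continuousOn.mono hStgtX)).sInf_mem (hne.image _)

theorem Hmax_mem_image (hgrad : S.BoundedGradient LH) (hStgt : IsCompact Stgt)
    (hne : Stgt.Nonempty) (hStgtX : Stgt ⊆ S.X) : S.Hmax Stgt ∈ S.H '' Stgt :=
  (hStgt.image_of_continuousOn (hgrad.continuousOn.mono hStgtX)).sSup_mem (hne.image _)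

theorem levelDist_Hmax (h : 0 < S.Hminus Stgt) : S.levelDist Stgt (S.Hmax Stgt) = 0 := by
  have : S.Hmax Stgt - S.Hplus Stgt = S.Hminus Stgt := by
    unfold Hplus Hminus
    ring
  rw [levelDist, this, abs_of_pos h, sub_self]

theorem levelDist_nonneg_of_notMem_Ioo {E : ℝ} (hE : E ∉ Ioo (S.Hmin Stgt) (S.Hmax Stgt)) :
    0 ≤ S.levelDist Stgt E := by
  by_contra! h
  refine hE ?_
  have h1 : |E - S.Hplus Stgt| < S.Hminus Stgt := by
    unfold levelDist at h
    linarith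
  rw [abs_lt] at h1
  unfold Hplus Hminus at h1
  constructor <;> linarith [h1.1, h1.2]

/-- A family of centers whose balls of radius `ρ` meet every energy layer outside the open target
band, with a number of balls controlled by the energy range that they cover. The centers lie on the
segment from the minimizer to the maximizer of `H`, where energies `E`, `E'` of points at distance
at least `ρ` differ by at least `μH ρ² / 2`; a maximal set of energies with this separation works.
A single ball covers an energy range of that size because it does not reach the level
`(Hmax + Hmin) / 2` on the segment. -/
theorem IsRegular.exists_energy_net (hS : S.IsRegular L LH) (hStgt : IsCompact Stgt)
    (hne : Stgt.Nonempty) (hStgtX : Stgt ⊆ S.X) (hμH : 0 < μH)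
    (hconv : S.StronglyConvexEnergy μH) (hε' : ε < S.Hminus Stgt) (hminus : 0 < S.Hminus Stgt)
    {ρ : ℝ} (hρ : 0 < ρ) (hρε : LH * ρ ≤ ε) :
    ∃ (F : Finset ℝ) (c : ℝ → Vec n), F.Nonempty ∧
      (∀ E ∈ F, c E ∈ S.X ∧ S.H (c E) = E ∧ 0 ≤ S.levelDist Stgt E) ∧
      (∀ E ∈ S.H '' S.X, 0 ≤ S.levelDist Stgt E →
        ∃ E' ∈ F, ∃ p ∈ S.X, S.H p = E ∧ ‖p - c E'‖ < ρ) ∧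
      (∀ H₁ H₂ : ℝ, (∀ E ∈ F, ∀ x ∈ S.X, ‖x - c E‖ ≤ ρ → H₁ ≤ S.H x ∧ S.H x ≤ H₂) →
        (F.card : ℝ) * (μH / 2 * ρ ^ 2) ≤ 2 * (H₂ - H₁)) := by
  have hXne : S.X.Nonempty := hne.mono hStgtX
  obtain ⟨z, hz, hzmin⟩ := S.isCompact_X.exists_isMinOn hXne hS.grad.continuousOn
  obtain ⟨w, hw, hwmax⟩ := S.isCompact_X.exists_isMaxOn hXne hS.grad.continuousOn
  have hmin : ∀ x ∈ S.X, S.H z ≤ S.H x := isMinOn_iff.1 hzmin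
  have hmax : ∀ x ∈ S.X, S.H x ≤ S.H w := isMaxOn_iff.1 hwmax
  set γ : ℝ → Vec n := fun s => z + s • (w - z) with hγ
  have hγX : ∀ s ∈ Icc (0 : ℝ) 1, γ s ∈ S.X := fun s hs => hS.convex.add_smul_sub_mem hz hw hs
  have hgap : ∀ s ∈ Icc (0 : ℝ) 1, ∀ t ∈ Icc (0 : ℝ) 1,
      μH / 2 * ‖γ s - γ t‖ ^ 2 ≤ |S.H (γ s) - S.H (γ t)| := fun s hs t ht =>
    hS.le_abs_H_sub_segment hz hw hmin hμH hconv hs ht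
  have hγc : Continuous γ := by fun_prop
  have hsurj : ∀ E ∈ S.H '' S.X, ∃ s ∈ Icc (0 : ℝ) 1, S.H (γ s) = E := by
    rintro E ⟨x, hx, rfl⟩
    have hc : ContinuousOn (fun s => S.H (γ s)) (Icc 0 1) :=
      hS.grad.continuousOn.comp hγc.continuousOn hγX
    refine intermediate_value_Icc zero_le_one hc ⟨?_, ?_⟩
    · simpa [hγ] using hmin x hx
    · simpa [hγ] using hmax x hx
  set δ := μH / 2 * ρ ^ 2 with hδdef
  have hδ : 0 < δ := by positivity
  choose! σ hσ hσE using hsurj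
  obtain ⟨F, hFne, hFC, hsep, hcov⟩ := exists_finset_separated_cover (lo := S.H z) (hi := S.H w)
    hδ (C := {E ∈ S.H '' S.X | 0 ≤ S.levelDist Stgt E})
    (by
      rintro _ ⟨⟨x, hx, rfl⟩, -⟩
      exact ⟨hmin x hx, hmax x hx⟩)
    ⟨S.Hmax Stgt, image_mono hStgtX (Hmax_mem_image hS.grad hStgt hne hStgtX),
      (levelDist_Hmax hminus).ge⟩
  have hFc : ∀ E ∈ F, γ (σ E) ∈ S.X ∧ S.H (γ (σ E)) = E ∧ 0 ≤ S.levelDist Stgt E := fun E hE =>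
    ⟨hγX _ (hσ E (hFC hE).1), hσE E (hFC hE).1, (hFC hE).2⟩
  refine ⟨F, fun E => γ (σ E), hFne, hFc, ?_, ?_⟩
  · intro E hE hE0
    obtain ⟨E', hE', hEE'⟩ := hcov E ⟨hE, hE0⟩
    refine ⟨E', hE', γ (σ E), hγX _ (hσ E hE), hσE E hE, ?_⟩
    have h1 := hgap _ (hσ E hE) _ (hσ E' (hFC hE').1)
    rw [hσE E hE, hσE E' (hFC hE').1] at h1
    have h2 : ‖γ (σ E) - γ (σ E')‖ ^ 2 < ρ ^ 2 :=
      lt_of_mul_lt_mul_left (h1.trans_lt hEE') (by positivity)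
    exact lt_of_pow_lt_pow_left₀ 2 hρ.le h2
  · intro H₁ H₂ hH
    obtain ⟨a, ha, b, hb, hab⟩ := F.exists_card_sub_one_mul_le_sub hFne hsep
    have hbound : ∀ E ∈ F, H₁ ≤ E ∧ E ≤ H₂ := by
      intro E hE
      obtain ⟨h1, h2, -⟩ := hFc E hE
      have := hH E hE _ h1 (by simpa using hρ.le)
      rwa [h2] at this
    have h1 : (F.card - 1 : ℝ) * δ ≤ H₂ - H₁ := by linarith [(hbound a ha).1, (hbound b hb).2]
    -- the point of the segment at distance `ρ` from a center, towards the level `Hplus`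
    have h2 : δ ≤ H₂ - H₁ := by
      obtain ⟨haX, haE, ha0⟩ := hFc a ha
      have hplus : S.Hplus Stgt ∈ S.H '' S.X := by
        have hconn : (S.H '' S.X).OrdConnected :=
          (hS.convex.isPreconnected.image _ hS.grad.continuousOn).ordConnected
        refine hconn.out (image_mono hStgtX (Hmin_mem_image hS.grad hStgt hne hStgtX))
          (image_mono hStgtX (Hmax_mem_image hS.grad hStgt hne hStgtX)) ?_
        unfold Hminus at hminus
        unfold Hplus
        constructor <;> linarith
      set α := σ a with hα
      set β := σ (S.Hplus Stgt) with hβ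
      have hαI : α ∈ Icc (0 : ℝ) 1 := hσ a (hFC ha).1
      have hβI : β ∈ Icc (0 : ℝ) 1 := hσ _ hplus
      have hβE : S.H (γ β) = S.Hplus Stgt := hσE _ hplus
      have hdist : ρ ≤ ‖γ α - γ β‖ := by
        have h3 := hS.abs_H_sub_le haX (hγX β hβI)
        rw [haE, hβE] at h3
        unfold levelDist at ha0
        refine le_of_mul_le_mul_left ?_ hS.LH_pos
        linarith
      have hpos : 0 < ‖γ α - γ β‖ := hρ.trans_le hdist
      set θ := ρ / ‖γ α - γ β‖ with hθ
      have hθ0 : 0 ≤ θ := by positivity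
      have hθ1 : θ ≤ 1 := (div_le_one hpos).2 hdist
      have hκ : α + θ * (β - α) ∈ Icc (0 : ℝ) 1 := by
        have := (convex_Icc (0 : ℝ) 1).add_smul_sub_mem hαI hβI ⟨hθ0, hθ1⟩
        simpa using this
      have hnorm : ‖γ (α + θ * (β - α)) - γ α‖ = ρ := by
        have h3 : γ (α + θ * (β - α)) - γ α = -(θ • (γ α - γ β)) := by
          simp only [hγ]
          module
        rw [h3, norm_neg, norm_smul, Real.norm_eq_abs, abs_of_nonneg hθ0, hθ,
          div_mul_cancel₀ _ hpos.ne']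
      have h4 := hgap _ hκ _ hαI
      rw [hnorm] at h4
      obtain ⟨h5, h6⟩ := hH a ha _ (hγX _ hκ) hnorm.le
      obtain ⟨h7, h8⟩ := hbound a ha
      have h9 : |S.H (γ (α + θ * (β - α))) - S.H (γ α)| ≤ H₂ - H₁ := by
        rw [haE, abs_le]
        constructor <;> linarith
      exact h4.trans h9
    linarith

end HamiltonianSystem

namespace HamiltonianSystem

variable {n m : ℕ} {S : HamiltonianSystem n m} {L LH ε : ℝ} {Stgt S₀ : Set (Vec n)}

/-! ### Ergodic energy layers -/

theorem IsRegular.continuousOn_zeroFlow (hS : S.IsRegular L LH) {t : ℝ} (ht : 0 ≤ t) :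
    ContinuousOn (S.zeroFlow t) S.X := by
  apply LipschitzOnWith.continuousOn (K := (Real.exp (L * t)).toNNReal)
  apply LipschitzOnWith.of_dist_le_mul
  intro x hx y hy
  rw [dist_eq_norm, dist_eq_norm, Real.coe_toNNReal _ (Real.exp_pos _).le, mul_comm]
  exact (isTrajectory_flow hS.fwd hx (admissible_zero hS.zero_mem)).norm_sub_le hS.L_pos.le
    hS.lip (admissible_zero hS.zero_mem)
    (isTrajectory_flow hS.fwd hy (admissible_zero hS.zero_mem)) ht

theorem IsRegular.isClosed_setOf_zeroFlow_notMem (hS : S.IsRegular L LH) {O : Set (Vec n)}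
    (hO : IsOpen O) : IsClosed {x ∈ S.X | ∀ t, 0 ≤ t → S.zeroFlow t x ∉ O} := by
  have h : {x ∈ S.X | ∀ t, 0 ≤ t → S.zeroFlow t x ∉ O}
      = S.X ∩ ⋂ t ∈ Ici (0 : ℝ), S.X ∩ S.zeroFlow t ⁻¹' Oᶜ := by
    ext x
    simp +contextual
  rw [h]
  exact S.isCompact_X.isClosed.inter (isClosed_biInter fun t ht =>
    (hS.continuousOn_zeroFlow ht).preimage_isClosed_of_isClosed S.isCompact_X.isClosed
      hO.isClosed_compl)

/-- On an ergodic energy layer with full support, almost every zero-input trajectory visits a given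
open set that meets the layer: the states that never visit it form a forward invariant set, which
cannot have full measure. -/
theorem IsRegular.measure_zeroFlow_notMem_eq_zero (hS : S.IsRegular L LH) {E : ℝ}
    {μ : Measure (Vec n)} (herg : IsErgodicOn S.zeroFlow (S.energyLayer E) μ)
    (hsupp : supportIn (S.energyLayer E) μ = S.energyLayer E) {O : Set (Vec n)} (hO : IsOpen O)
    (hne : (O ∩ S.energyLayer E).Nonempty) :
    μ {x ∈ S.energyLayer E | ∀ t, 0 ≤ t → S.zeroFlow t x ∉ O} = 0 := by
  have := herg.1.1
  set A := {x ∈ S.energyLayer E | ∀ t, 0 ≤ t → S.zeroFlow t x ∉ O} with hA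
  have hlayer : IsClosed (S.energyLayer E) :=
    hS.grad.continuousOn.preimage_isClosed_of_isClosed S.isCompact_X.isClosed isClosed_singleton
  have hAcl : IsClosed A := by
    have h : A = S.energyLayer E ∩ {x ∈ S.X | ∀ t, 0 ≤ t → S.zeroFlow t x ∉ O} := by
      ext x
      exact ⟨fun h => ⟨h.1, h.1.1, h.2⟩, fun h => ⟨h.1, h.2.2⟩⟩
    rw [h]
    exact hlayer.inter (hS.isClosed_setOf_zeroFlow_notMem hO)
  have hinv : ∀ t, 0 ≤ t → S.zeroFlow t '' A ⊆ A := by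
    rintro t ht _ ⟨x, hx, rfl⟩
    refine ⟨⟨zeroFlow_mem hS.zero_mem hS.fwd hx.1.1 ht, ?_⟩, fun s hs => ?_⟩
    · rw [H_zeroFlow hS.L_pos.le hS.lip hS.zero_mem hS.fwd hS.grad hx.1.1 ht, hx.1.2]
    · rw [← zeroFlow_add hS.L_pos.le hS.lip hS.zero_mem hS.fwd hx.1.1 ht hs]
      exact hx.2 _ (add_nonneg ht hs)
  rcases herg.2 A (fun x hx => hx.1) hAcl.measurableSet hinv with h | h
  · exact h
  · exfalso
    obtain ⟨x, hxO, hx⟩ := hne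
    obtain ⟨r, hr, hball⟩ := Metric.nhds_basis_closedBall.mem_iff.1 (hO.mem_nhds hxO)
    rw [← hsupp] at hx
    refine (hx.2 r hr).ne' (measure_mono_null ?_ ((prob_compl_eq_zero_iff hAcl.measurableSet).2 h))
    intro y hy hyA
    have := hyA.2 0 le_rfl
    rw [zeroFlow_zero hS.zero_mem hS.fwd hyA.1.1] at this
    exact this (hball hy)

theorem BoundedGradient.measurableSet_inter_preimage (hgrad : S.BoundedGradient LH) {A : Set ℝ}
    (hA : MeasurableSet A) : MeasurableSet {x ∈ S.X | S.H x ∈ A} := by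
  have h := (continuousOn_iff_continuous_domRestrict.1 hgrad.continuousOn).measurable hA
  have h2 := S.isCompact_X.isClosed.measurableSet.subtype_image h
  convert h2 using 1
  ext x
  simp [and_comm]

theorem measurableSet_relevantEnergies (hgrad : S.BoundedGradient LH) (hS₀ : IsCompact S₀)
    (hS₀X : S₀ ⊆ S.X) : MeasurableSet (S.relevantEnergies Stgt S₀) := by
  rcases S₀.eq_empty_or_nonempty with rfl | hne
  · simp [relevantEnergies]
  · obtain ⟨y, hy, hymax⟩ := hS₀.exists_isMaxOn hne
      ((hgrad.continuousOn_DH (Stgt := Stgt)).mono hS₀X)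
    have h : S.relevantEnergies Stgt S₀
        = S.H '' S.X ∩ S.levelDist Stgt ⁻¹' Iic (S.DH Stgt y) := by
      ext E
      exact ⟨fun ⟨h1, x, hx, h2⟩ => ⟨h1, h2.trans (isMaxOn_iff.1 hymax x hx)⟩,
        fun ⟨h1, h2⟩ => ⟨h1, y, hy, h2⟩⟩
    rw [h]
    exact (S.isCompact_X.image_of_continuousOn hgrad.continuousOn).measurableSet.inter
      (continuous_levelDist.measurable measurableSet_Iic)

/-- Almost every state with relevant energy in `A` visits, under zero input, a given open set that
meets all the layers of relevant energies in `A`. -/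
theorem IsRegular.volume_zeroFlow_notMem_eq_zero (hS : S.IsRegular L LH) (hS₀ : IsCompact S₀)
    (hS₀X : S₀ ⊆ S.X) {μ : ℝ → Measure (Vec n)}
    (herg : ∀ E ∈ S.relevantEnergies Stgt S₀,
      IsErgodicOn S.zeroFlow (S.energyLayer E) (μ E) ∧
      supportIn (S.energyLayer E) (μ E) = S.energyLayer E)
    (hnull : ∀ B ⊆ {x ∈ S.X | S.H x ∈ S.relevantEnergies Stgt S₀}, MeasurableSet B →
      (∀ E ∈ S.relevantEnergies Stgt S₀, μ E B = 0) → volume B = 0)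
    {A : Set ℝ} (hA : MeasurableSet A) {O : Set (Vec n)} (hO : IsOpen O)
    (hAO : ∀ E ∈ S.relevantEnergies Stgt S₀, E ∈ A → (O ∩ S.energyLayer E).Nonempty) :
    volume {x ∈ S.X | S.H x ∈ S.relevantEnergies Stgt S₀ ∩ A ∧
      ∀ t, 0 ≤ t → S.zeroFlow t x ∉ O} = 0 := by
  refine hnull _ (fun x hx => ⟨hx.1, hx.2.1.1⟩) ?_ ?_
  · have h : {x ∈ S.X | S.H x ∈ S.relevantEnergies Stgt S₀ ∩ A ∧
        ∀ t, 0 ≤ t → S.zeroFlow t x ∉ O}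
        = {x ∈ S.X | S.H x ∈ S.relevantEnergies Stgt S₀ ∩ A} ∩
          {x ∈ S.X | ∀ t, 0 ≤ t → S.zeroFlow t x ∉ O} := by
      ext x
      exact ⟨fun h => ⟨⟨h.1, h.2.1⟩, h.1, h.2.2⟩, fun h => ⟨h.1.1, h.1.2, h.2.2⟩⟩
    rw [h]
    exact (hS.grad.measurableSet_inter_preimage
      ((measurableSet_relevantEnergies hS.grad hS₀ hS₀X).inter hA)).inter
      (hS.isClosed_setOf_zeroFlow_notMem hO).measurableSet
  · intro E hE
    have hcompl : μ E (S.energyLayer E)ᶜ = 0 := (herg E hE).1.1.2.1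
    by_cases hEA : E ∈ A
    · refine measure_mono_null ?_ (measure_union_null (hS.measure_zeroFlow_notMem_eq_zero
        (herg E hE).1 (herg E hE).2 hO (hAO E hE hEA)) hcompl)
      intro x hx
      by_cases hxE : S.H x = E
      · exact Or.inl ⟨⟨hx.1, hxE⟩, hx.2.2⟩
      · exact Or.inr fun h => hxE h.2
    · refine measure_mono_null ?_ hcompl
      intro x hx h
      exact hEA (h.2 ▸ hx.2.1.2)

end HamiltonianSystem

namespace ChainPolicy

variable {n m N : ℕ} {K : Fin N → Assignment n m} {S : HamiltonianSystem n m} {L LH ε : ℝ}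
  {Stgt : Set (Vec n)} {τ₀ : ℝ} {ι : Vec n → Option (Fin N)}

/-! ### Execution of a chain policy -/

theorem iInf_normDist_le (x : Vec n) (i : Fin N) : (⨅ j, normDist K x j) ≤ normDist K x i :=
  ciInf_le (finite_range _).bddBelow i

theorem normDist_le_one_iff {x : Vec n} {i : Fin N} (hr : 0 < (K i).radius) :
    normDist K x i ≤ 1 ↔ ‖x - (K i).center‖ ≤ (K i).radius := by
  rw [normDist, div_le_one hr]

theorem IsIndexMap.normDist_le_one (hι : IsIndexMap K S.X ι) {x : Vec n} (hx : x ∈ S.X)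
    {i : Fin N} (hi : ι x = some i) : normDist K x i ≤ 1 := by
  by_cases h : (⨅ j, normDist K x j) ≤ 1
  · obtain ⟨j, hj, hj'⟩ := (hι x hx).1 h
    rw [hi, Option.some.injEq] at hj
    rw [hj, hj']
    exact h
  · rw [(hι x hx).2 (not_le.1 h)] at hi
    exact absurd hi (by simp)

theorem IsIndexMap.one_lt_normDist (hι : IsIndexMap K S.X ι) {x : Vec n} (hx : x ∈ S.X)
    (h : ι x = none) (i : Fin N) : 1 < normDist K x i := by
  by_contra! hle
  obtain ⟨j, hj, -⟩ := (hι x hx).1 ((iInf_normDist_le x i).trans hle)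
  rw [h] at hj
  exact absurd hj (by simp)

theorem admissible_control (hU : (0 : Vec m) ∈ S.U) (hadm : ∀ i, S.Admissible (K i).control)
    (o : Option (Fin N)) : S.Admissible (control K o) := by
  cases o with
  | none => exact HamiltonianSystem.admissible_zero hU
  | some i => exact hadm i

theorem duration_nonneg (hdur : ∀ i, 0 < (K i).duration) (hτ₀ : 0 < τ₀) (o : Option (Fin N)) :
    0 ≤ duration K τ₀ o := by
  cases o with
  | none => exact hτ₀.le
  | some i => exact (hdur i).le

theorem time_nonneg (hdur : ∀ i, 0 < (K i).duration) (hτ₀ : 0 < τ₀) (x₀ : Vec n) (k : ℕ) :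
    0 ≤ time K S τ₀ ι x₀ k :=
  Finset.sum_nonneg fun _ _ => duration_nonneg hdur hτ₀ _

theorem state_mem (hS : S.IsRegular L LH) (hadm : ∀ i, S.Admissible (K i).control)
    (hdur : ∀ i, 0 < (K i).duration) (hτ₀ : 0 < τ₀) {x₀ : Vec n} (hx₀ : x₀ ∈ S.X) (k : ℕ) :
    state K S τ₀ ι x₀ k ∈ S.X := by
  induction k with
  | zero => exact hx₀
  | succ k ih =>
    exact HamiltonianSystem.flow_mem hS.fwd ih (admissible_control hS.zero_mem hadm _)
      (duration_nonneg hdur hτ₀ _)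

/-- The state maps of the policy pull null sets back to null sets, although the index map need not
be measurable: each step splits into finitely many flow maps, and outer measure suffices. -/
theorem volume_state_preimage_eq_zero (hS : S.IsRegular L LH)
    (hadm : ∀ i, S.Admissible (K i).control) (hdur : ∀ i, 0 < (K i).duration) (hτ₀ : 0 < τ₀)
    (k : ℕ) {B : Set (Vec n)} (hB : volume B = 0) :
    volume {x₀ ∈ S.X | state K S τ₀ ι x₀ k ∈ B} = 0 := by
  induction k generalizing B with
  | zero => exact measure_mono_null (fun x hx => hx.2) hB
  | succ k ih =>
    refine measure_mono_null ?_ (measure_iUnion_null fun o : Option (Fin N) =>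
      ih (HamiltonianSystem.volume_flow_preimage_eq_zero hS.L_pos.le hS.lip hS.fwd
        (admissible_control hS.zero_mem hadm o) (duration_nonneg hdur hτ₀ o) hB))
    intro x hx
    exact mem_iUnion.2 ⟨ι (state K S τ₀ ι x k), hx.1, state_mem hS hadm hdur hτ₀ hx.1 k, hx.2⟩

theorem DH_state_succ_of_none (hS : S.IsRegular L LH) (hadm : ∀ i, S.Admissible (K i).control)
    (hdur : ∀ i, 0 < (K i).duration) (hτ₀ : 0 < τ₀) {x₀ : Vec n} (hx₀ : x₀ ∈ S.X) {k : ℕ}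
    (hk : ι (state K S τ₀ ι x₀ k) = none) :
    S.DH Stgt (state K S τ₀ ι x₀ (k + 1)) = S.DH Stgt (state K S τ₀ ι x₀ k) := by
  have h := HamiltonianSystem.H_zeroFlow hS.L_pos.le hS.lip hS.zero_mem hS.fwd hS.grad
    (state_mem (ι := ι) hS hadm hdur hτ₀ hx₀ k) hτ₀.le
  rw [state, hk, HamiltonianSystem.DH, HamiltonianSystem.DH]
  exact congrArg (S.levelDist Stgt) h

/-- Since every snippet decreases the energy distance by a fixed amount and the default snippet
keeps it, only finitely many snippets are executed. -/
theorem exists_forall_ge_eq_none (hS : S.IsRegular L LH) (hadm : ∀ i, S.Admissible (K i).control)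
    (hdur : ∀ i, 0 < (K i).duration) (hτ₀ : 0 < τ₀) (hι : IsIndexMap K S.X ι) {κ : ℝ} (hκ : 0 < κ)
    (hdec : ∀ i, ∀ x ∈ S.X, normDist K x i ≤ 1 →
      S.DH Stgt (S.flow (K i).duration x (K i).control) ≤ S.DH Stgt x - κ)
    {x₀ : Vec n} (hx₀ : x₀ ∈ S.X) :
    ∃ k₀, S.DH Stgt (state K S τ₀ ι x₀ k₀) ≤ S.DH Stgt x₀ ∧
      ∀ k ≥ k₀, ι (state K S τ₀ ι x₀ k) = none := by
  have hsome : ∀ k, ι (state K S τ₀ ι x₀ k) ≠ none →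
      S.DH Stgt (state K S τ₀ ι x₀ (k + 1)) ≤ S.DH Stgt (state K S τ₀ ι x₀ k) - κ := by
    intro k hk
    obtain ⟨i, hi⟩ := Option.ne_none_iff_exists'.1 hk
    have hmem := state_mem (ι := ι) hS hadm hdur hτ₀ hx₀ k
    rw [state, hi]
    exact hdec i _ hmem (hι.normDist_le_one hmem hi)
  have hanti : Antitone fun k => S.DH Stgt (state K S τ₀ ι x₀ k) := by
    refine antitone_nat_of_succ_le fun k => ?_
    by_cases hk : ι (state K S τ₀ ι x₀ k) = none
    · exact (DH_state_succ_of_none hS hadm hdur hτ₀ hx₀ hk).le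
    · linarith [hsome k hk]
  by_contra! h
  have hdrop : ∀ j : ℕ, ∃ k, S.DH Stgt (state K S τ₀ ι x₀ k) ≤ S.DH Stgt x₀ - j * κ := by
    intro j
    induction j with
    | zero => exact ⟨0, by simp [state]⟩
    | succ j ih =>
      obtain ⟨k, hk⟩ := ih
      obtain ⟨l, hl, hl'⟩ := h k (hanti (Nat.zero_le k))
      refine ⟨l + 1, ?_⟩
      have h1 := hsome l hl'
      have h2 : S.DH Stgt (state K S τ₀ ι x₀ l) ≤ S.DH Stgt (state K S τ₀ ι x₀ k) := hanti hl
      push_cast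
      linarith
  obtain ⟨j, hj⟩ := exists_nat_gt ((S.DH Stgt x₀ + S.Hminus Stgt) / κ)
  obtain ⟨k, hk⟩ := hdrop j
  rw [div_lt_iff₀ hκ] at hj
  have hlow : -S.Hminus Stgt ≤ S.DH Stgt (state K S τ₀ ι x₀ k) := by
    have := abs_nonneg (S.H (state K S τ₀ ι x₀ k) - S.Hplus Stgt)
    unfold HamiltonianSystem.DH HamiltonianSystem.levelDist
    linarith
  linarith

theorem state_add_of_eq_none (hS : S.IsRegular L LH) (hadm : ∀ i, S.Admissible (K i).control)
    (hdur : ∀ i, 0 < (K i).duration) (hτ₀ : 0 < τ₀) {x₀ : Vec n} (hx₀ : x₀ ∈ S.X) {k₀ : ℕ}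
    (hk₀ : ∀ k ≥ k₀, ι (state K S τ₀ ι x₀ k) = none) (j : ℕ) :
    state K S τ₀ ι x₀ (k₀ + j) = S.zeroFlow (j * τ₀) (state K S τ₀ ι x₀ k₀) := by
  have hmem := state_mem (ι := ι) hS hadm hdur hτ₀ hx₀ k₀
  induction j with
  | zero => simp [HamiltonianSystem.zeroFlow_zero hS.zero_mem hS.fwd hmem]
  | succ j ih =>
    have h1 : state K S τ₀ ι x₀ (k₀ + (j + 1)) = S.zeroFlow τ₀ (state K S τ₀ ι x₀ (k₀ + j)) := by
      rw [← add_assoc, state, hk₀ _ (Nat.le_add_right _ _)]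
      rfl
    rw [h1, ih, ← HamiltonianSystem.zeroFlow_add hS.L_pos.le hS.lip hS.zero_mem hS.fwd hmem
      (by positivity) hτ₀.le]
    push_cast
    ring_nf

theorem time_succ_of_none {x₀ : Vec n} {k : ℕ} (hk : ι (state K S τ₀ ι x₀ k) = none) :
    time K S τ₀ ι x₀ (k + 1) = time K S τ₀ ι x₀ k + τ₀ := by
  rw [time, Finset.sum_range_succ, hk]
  rfl

theorem inAt_of_zeroFlow_mem (hS : S.IsRegular L LH) (hadm : ∀ i, S.Admissible (K i).control)
    (hdur : ∀ i, 0 < (K i).duration) (hτ₀ : 0 < τ₀) {x₀ : Vec n} (hx₀ : x₀ ∈ S.X) {k₀ : ℕ}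
    (hk₀ : ∀ k ≥ k₀, ι (state K S τ₀ ι x₀ k) = none) {A : Set (Vec n)} {t : ℝ} (ht : 0 ≤ t)
    (hA : S.zeroFlow t (state K S τ₀ ι x₀ k₀) ∈ A) :
    InAt K S τ₀ ι x₀ A (time K S τ₀ ι x₀ k₀ + t) := by
  have htime : ∀ j : ℕ, time K S τ₀ ι x₀ (k₀ + j) = time K S τ₀ ι x₀ k₀ + j * τ₀ := by
    intro j
    induction j with
    | zero => simp
    | succ j ih =>
      rw [← add_assoc, time_succ_of_none (hk₀ _ (Nat.le_add_right _ _)), ih]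
      push_cast
      ring
  set j := ⌊t / τ₀⌋₊ with hj
  have h1 : j * τ₀ ≤ t := (le_div_iff₀ hτ₀).1 (Nat.floor_le (by positivity))
  have h2 : t < (j + 1) * τ₀ := (div_lt_iff₀ hτ₀).1 (Nat.lt_floor_add_one _)
  refine ⟨k₀ + j, ?_, ?_, ?_⟩
  · rw [htime]
    linarith
  · rw [add_assoc, htime]
    push_cast
    linarith
  · rw [hk₀ _ (Nat.le_add_right _ _), htime, state_add_of_eq_none hS hadm hdur hτ₀ hx₀ hk₀]
    have h3 := HamiltonianSystem.zeroFlow_add hS.L_pos.le hS.lip hS.zero_mem hS.fwd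
      (state_mem (ι := ι) hS hadm hdur hτ₀ hx₀ k₀) (s := j * τ₀) (t := t - j * τ₀)
      (by positivity) (by linarith)
    rw [show (j : ℝ) * τ₀ + (t - j * τ₀) = t by ring] at h3
    rw [h3] at hA
    rw [show time K S τ₀ ι x₀ k₀ + t - (time K S τ₀ ι x₀ k₀ + j * τ₀) = t - j * τ₀ by ring]
    exact hA

/-- If the default duration is so short that the zero-input flow moves by at most `δ` within it, a
state from which only the default snippet is executed never enters, under zero input, the balls of
the assignment set shrunk by `δ`: it would still be in the support at the next decision instant. -/
theorem zeroFlow_notMem_ball (hS : S.IsRegular L LH) (hadm : ∀ i, S.Admissible (K i).control)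
    (hdur : ∀ i, 0 < (K i).duration) (hrad : ∀ i, 0 < (K i).radius) (hτ₀ : 0 < τ₀)
    (hι : IsIndexMap K S.X ι) {M ρ δ : ℝ} (hM : ∀ x ∈ S.X, ‖S.f x 0‖ ≤ M) (hM0 : 0 < M)
    (hδ : M * τ₀ ≤ δ) (hρ : ∀ i, ρ + δ ≤ (K i).radius) {x₀ : Vec n} (hx₀ : x₀ ∈ S.X) {k₀ : ℕ}
    (hk₀ : ∀ k ≥ k₀, ι (state K S τ₀ ι x₀ k) = none) {t : ℝ} (ht : 0 ≤ t) (i : Fin N) :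
    S.zeroFlow t (state K S τ₀ ι x₀ k₀) ∉ Metric.ball (K i).center ρ := by
  intro hball
  set y := state K S τ₀ ι x₀ k₀ with hy
  have hymem : y ∈ S.X := state_mem hS hadm hdur hτ₀ hx₀ k₀
  set j := ⌈t / τ₀⌉₊ with hj
  have h1 : t ≤ j * τ₀ := (div_le_iff₀ hτ₀).1 (Nat.le_ceil _)
  have h2 : j * τ₀ ≤ t + τ₀ := by
    have h := (Nat.ceil_lt_add_one (div_nonneg ht hτ₀.le)).le
    calc (j : ℝ) * τ₀ ≤ (t / τ₀ + 1) * τ₀ := mul_le_mul_of_nonneg_right h hτ₀.le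
      _ = t + τ₀ := by field_simp
  have h3 := HamiltonianSystem.norm_zeroFlow_sub_le hS.zero_mem hS.fwd hM hymem ht h1
  have h4 : M * (j * τ₀ - t) ≤ M * τ₀ := mul_le_mul_of_nonneg_left (by linarith) hM0.le
  have h5 := hι.one_lt_normDist (state_mem hS hadm hdur hτ₀ hx₀ (k₀ + j))
    (hk₀ _ (Nat.le_add_right k₀ j)) i
  refine absurd ((normDist_le_one_iff (hrad i)).2 ?_) (not_le.2 h5)
  rw [state_add_of_eq_none hS hadm hdur hτ₀ hx₀ hk₀]
  rw [Metric.mem_ball, dist_eq_norm] at hball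
  have h6 := norm_sub_le_norm_sub_add_norm_sub (S.zeroFlow (j * τ₀) y) (S.zeroFlow t y)
    (K i).center
  linarith [hρ i]

end ChainPolicy

namespace ChainPolicy

variable {n m N : ℕ} {K : Fin N → Assignment n m} {S : HamiltonianSystem n m} {L LH ε : ℝ}
  {Stgt S₀ : Set (Vec n)}

/-! ### Reachability of the target and the choice of the assignment set -/

theorem isCompact_Supp_inter : IsCompact (Supp K ∩ S.X) :=
  S.isCompact_X.inter_left (isClosed_iUnion_of_finite fun _ => Metric.isClosed_closedBall)

/-- If the balls of radius `ρ` meet all relevant layers outside the open target band, the chain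
policy reaches the target from almost every initial state. After the last snippet only the zero
input is applied. Outside the band this confines the state to a null set, because almost all
zero-input trajectories visit one of the balls; inside the band almost all of them visit the
interior of the target. -/
theorem exists_inAt_of_energy_cover [Nonempty (Fin N)] (hS : S.IsRegular L LH)
    (hS₀ : IsCompact S₀) (hS₀X : S₀ ⊆ S.X) {μ : ℝ → Measure (Vec n)}
    (herg : ∀ E ∈ S.relevantEnergies Stgt S₀,
      IsErgodicOn S.zeroFlow (S.energyLayer E) (μ E) ∧
      supportIn (S.energyLayer E) (μ E) = S.energyLayer E)
    (hnull : ∀ B ⊆ {x ∈ S.X | S.H x ∈ S.relevantEnergies Stgt S₀}, MeasurableSet B →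
      (∀ E ∈ S.relevantEnergies Stgt S₀, μ E B = 0) → volume B = 0)
    (htgt : ∀ E ∈ Ioo (S.Hmin Stgt) (S.Hmax Stgt),
      (interior Stgt ∩ S.energyLayer E).Nonempty)
    (hadm : ∀ i, S.Admissible (K i).control) (hdur : ∀ i, 0 < (K i).duration)
    {ρ : ℝ} (hρ : 0 < ρ) (hρK : ∀ i, ρ < (K i).radius)
    (hcov : ∀ E ∈ S.H '' S.X, 0 ≤ S.levelDist Stgt E →
      ∃ i, ∃ p ∈ S.X, S.H p = E ∧ ‖p - (K i).center‖ < ρ)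
    (hdec : ∃ κ, 0 < κ ∧ ∀ i, ∀ x ∈ S.X, normDist K x i ≤ 1 →
      S.DH Stgt (S.flow (K i).duration x (K i).control) ≤ S.DH Stgt x - κ) :
    ∃ τmax : ℝ, 0 < τmax ∧ ∀ τ₀ : ℝ, 0 < τ₀ → τ₀ ≤ τmax → ∀ ι, IsIndexMap K S.X ι →
      ∀ᵐ x₀ ∂(volume.restrict S₀), ∃ t : ℝ, 0 ≤ t ∧ InAt K S τ₀ ι x₀ Stgt t := by
  obtain ⟨κ, hκ, hdec⟩ := hdec
  obtain ⟨M, hM0, hM⟩ := HamiltonianSystem.exists_norm_f_le hS.L_pos.le hS.lip hS.zero_mem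
  obtain ⟨i₀, hi₀⟩ := Finite.exists_min fun i => (K i).radius
  set δ := (K i₀).radius - ρ with hδ
  have hδ0 : 0 < δ := sub_pos.2 (hρK i₀)
  refine ⟨δ / M, div_pos hδ0 hM0, fun τ₀ hτ₀ hτ ι hι => ?_⟩
  have hMτ : M * τ₀ ≤ δ := by
    rw [mul_comm]
    exact (le_div_iff₀ hM0).1 hτ
  set O : Set (Vec n) := ⋃ i, Metric.ball (K i).center ρ with hO
  have hband := hS.volume_zeroFlow_notMem_eq_zero hS₀ hS₀X herg hnull
    (measurableSet_Ioo (a := S.Hmin Stgt) (b := S.Hmax Stgt)) (isOpen_interior (s := Stgt))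
    fun E _ hE => htgt E hE
  have hout := hS.volume_zeroFlow_notMem_eq_zero hS₀ hS₀X herg hnull
    (measurableSet_Ioo (a := S.Hmin Stgt) (b := S.Hmax Stgt)).compl
    (isOpen_iUnion fun i => Metric.isOpen_ball : IsOpen O) fun E hErel hE => by
      obtain ⟨i, p, hp, hpE, hpi⟩ :=
        hcov E hErel.1 (HamiltonianSystem.levelDist_nonneg_of_notMem_Ioo hE)
      exact ⟨p, mem_iUnion.2 ⟨i, by rwa [Metric.mem_ball, dist_eq_norm]⟩, hp, hpE⟩
  rw [ae_restrict_iff' hS₀.measurableSet, ae_iff]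
  refine measure_mono_null ?_ (measure_iUnion_null fun k : ℕ =>
    volume_state_preimage_eq_zero (ι := ι) hS hadm hdur hτ₀ k (measure_union_null hband hout))
  intro x₀ hx₀
  rw [mem_ofPred_eq, Classical.not_imp] at hx₀
  obtain ⟨hx₀S, hx₀⟩ := hx₀
  have hx₀X := hS₀X hx₀S
  obtain ⟨k₀, hk₀le, hk₀⟩ := exists_forall_ge_eq_none (Stgt := Stgt) hS hadm hdur hτ₀ hι hκ hdec
    hx₀X
  have hy : state K S τ₀ ι x₀ k₀ ∈ S.X := state_mem hS hadm hdur hτ₀ hx₀X k₀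
  have hrel : S.H (state K S τ₀ ι x₀ k₀) ∈ S.relevantEnergies Stgt S₀ :=
    ⟨mem_image_of_mem _ hy, x₀, hx₀S, hk₀le⟩
  refine mem_iUnion.2 ⟨k₀, hx₀X, ?_⟩
  by_cases hE : S.H (state K S τ₀ ι x₀ k₀) ∈ Ioo (S.Hmin Stgt) (S.Hmax Stgt)
  · refine Or.inl ⟨hy, ⟨hrel, hE⟩, fun t ht hmem => hx₀ ?_⟩
    exact ⟨_, add_nonneg (time_nonneg hdur hτ₀ x₀ k₀) ht,
      inAt_of_zeroFlow_mem hS hadm hdur hτ₀ hx₀X hk₀ ht (interior_subset hmem)⟩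
  · refine Or.inr ⟨hy, ⟨hrel, hE⟩, fun t ht hmem => ?_⟩
    obtain ⟨i, hi⟩ := mem_iUnion.1 hmem
    exact zeroFlow_notMem_ball hS hadm hdur (fun i => hρ.trans (hρK i)) hτ₀ hι hM hM0 hMτ
      (fun i => by linarith [hi₀ i]) hx₀X hk₀ ht i hi

end ChainPolicy

open HamiltonianSystem ChainPolicy

theorem mainTheorem2 {n m : ℕ} (S : HamiltonianSystem n m) (S₀ Stgt : Set (Vec n))
    (L LH μH ε v₀ : ℝ) (μ : ℝ → Measure (Vec n))
    -- the state set, the inputs, the initial states and the target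
    (hX : Convex ℝ S.X) (hU : (0 : Vec m) ∈ S.U)
    (hS₀ : IsCompact S₀) (hS₀X : S₀ ⊆ S.X)
    (hStgt : IsCompact Stgt) (hStgt_conn : IsConnected Stgt) (hStgtX : Stgt ⊆ S.X)
    -- bounded gradient, Lipschitz dynamics, state trajectories stay in the state set
    (hLH : 0 < LH) (hgrad : S.BoundedGradient LH)
    (hL : 0 < L) (hlip : S.LipschitzDynamics L)
    (hfwd : S.ForwardComplete)
    -- the energy margin, reachability of the shrunken band, existence of optimal controls
    (hε : 0 < ε) (hε' : ε < S.Hminus Stgt)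
    (hreach : S.TargetBandReachable Stgt ε)
    (hopt : ∀ x ∈ S.X \ S.Htgt Stgt ε, ∃ u, S.IsOptimalControl Stgt ε x u)
    -- the minimal decrease rate is positive and exceeds the certified rate
    (hv₀ : 0 < v₀) (hv : v₀ < S.minRate Stgt ε)
    -- strong convexity of the energy
    (hμH : 0 < μH) (hconv : S.StronglyConvexEnergy μH)
    -- each relevant energy layer is ergodic, with full support
    (herg : ∀ E ∈ S.relevantEnergies Stgt S₀,
      IsErgodicOn S.zeroFlow (S.energyLayer E) (μ E) ∧
      supportIn (S.energyLayer E) (μ E) = S.energyLayer E)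
    -- a set of states that is null on each relevant layer is Lebesgue null
    (hnull : ∀ B ⊆ {x ∈ S.X | S.H x ∈ S.relevantEnergies Stgt S₀}, MeasurableSet B →
      (∀ E ∈ S.relevantEnergies Stgt S₀, μ E B = 0) → volume B = 0)
    -- the target covers each layer of the band
    (htgt : ∀ E ∈ Ioo (S.Hmin Stgt) (S.Hmax Stgt),
      (interior Stgt ∩ S.energyLayer E).Nonempty) :
    ∃ (N : ℕ) (K : Fin N → Assignment n m), 0 < N ∧
      -- the assignments consist of optimal hitting controls and certified radii
      (∀ i, (K i).center ∈ S.X \ S.Htgt Stgt ε ∧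
        S.IsOptimalControl Stgt ε (K i).center (K i).control ∧
        0 < (K i).duration ∧
        ENNReal.ofReal (K i).duration = S.optHitTime Stgt ε (K i).center ∧
        S.flow (K i).duration (K i).center (K i).control ∈ frontier (S.Htgt Stgt ε) ∧
        (K i).radius = S.certRadius Stgt L LH ε v₀ (K i).center ∧
        0 < (K i).radius) ∧
      -- reachability
      (∃ τmax : ℝ, 0 < τmax ∧ ∀ τ₀ : ℝ, 0 < τ₀ → τ₀ ≤ τmax →
        ∀ ι, ChainPolicy.IsIndexMap K S.X ι →
          ∀ᵐ x₀ ∂(volume.restrict S₀),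
            ∃ t : ℝ, 0 ≤ t ∧ ChainPolicy.InAt K S τ₀ ι x₀ Stgt t) ∧
      -- sample complexity
      (∃ H₁ H₂ : ℝ,
        IsLeast (S.H '' (ChainPolicy.Supp K ∩ S.X)) H₁ ∧
        IsGreatest (S.H '' (ChainPolicy.Supp K ∩ S.X)) H₂ ∧
        (N : ℝ) ≤ (H₂ - H₁) *
          (16 * LH ^ 2 / (μH * (1 - v₀ / S.minRate Stgt ε) ^ 2)) *
          (Real.exp (2 * L * (LH * Metric.diam S.X + ε) / S.minRate Stgt ε) / ε ^ 2)) := by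
  have hS : S.IsRegular L LH := ⟨hX, hU, hLH, hgrad, hL, hlip, hfwd⟩
  have hne : Stgt.Nonempty := hStgt_conn.nonempty
  have hvpos : 0 < S.minRate Stgt ε := hv₀.trans hv
  have hq : 0 < 1 - v₀ / S.minRate Stgt ε := by
    rw [sub_pos, div_lt_one hvpos]
    exact hv
  set ρ := radiusBound S Stgt L LH ε v₀ with hρdef
  have hexp : 1 ≤ Real.exp (L * (LH * Metric.diam S.X + ε) / S.minRate Stgt ε) := by
    refine Real.one_le_exp ?_
    have := Metric.diam_nonneg (s := S.X)
    positivity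
  have hρ : 0 < ρ := div_pos (mul_pos hq hε) (by positivity)
  have hρε : LH * ρ ≤ ε := by
    have h1 : LH * ρ = (1 - v₀ / S.minRate Stgt ε) * ε /
        (2 * Real.exp (L * (LH * Metric.diam S.X + ε) / S.minRate Stgt ε)) := by
      rw [hρdef, radiusBound]
      field_simp
    rw [h1]
    refine div_le_of_le_mul₀ (by positivity) hε.le ?_
    have h2 : (1 - v₀ / S.minRate Stgt ε) * ε ≤ 1 * ε :=
      mul_le_mul_of_nonneg_right (by linarith [div_pos hv₀ hvpos]) hε.le
    nlinarith
  obtain ⟨F, c, hFne, hFc, hcov, hcard⟩ := hS.exists_energy_net hStgt hne hStgtX hμH hconv hε'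
    (hε.trans hε') hρ hρε
  obtain ⟨y, hy, hyE⟩ := Hmax_mem_image hgrad hStgt hne hStgtX
  have hy0 : S.DH Stgt y ≤ 0 := by
    rw [DH, hyE, levelDist_Hmax (hε.trans hε')]
  choose! w hw using hopt
  have hopt' : ∀ x ∈ S.X \ S.Htgt Stgt ε, ∃ u, S.IsOptimalControl Stgt ε x u :=
    fun x hx => ⟨w x, hw x hx⟩
  have hDH : ∀ E ∈ F, 0 ≤ S.DH Stgt (c E) := by
    intro E hE
    rw [DH, (hFc E hE).2.1]
    exact (hFc E hE).2.2
  have hcmem : ∀ E ∈ F, c E ∈ S.X \ S.Htgt Stgt ε := fun E hE =>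
    ⟨(hFc E hE).1, fun h => by linarith [h.2, hDH E hE]⟩
  let e := F.equivFin.symm
  let K : Fin F.card → Assignment n m := fun i =>
    ⟨c (e i), S.certRadius Stgt L LH ε v₀ (c (e i)), S.optTime Stgt ε (c (e i)), w (c (e i))⟩
  have hcen : ∀ i, (K i).center ∈ S.X \ S.Htgt Stgt ε := fun i => hcmem _ (e i).2
  have hctrl : ∀ i, S.IsOptimalControl Stgt ε (K i).center (K i).control := fun i => hw _ (hcen i)
  have hdur : ∀ i, 0 < (K i).duration := fun i =>
    (hS.bestRate_mul_optTime hreach (hcen i) (hctrl i)).1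
  have hrad : ∀ i, ρ < (K i).radius := fun i =>
    hS.radiusBound_lt_certRadius hreach hopt' hε hv₀ hv (hcen i) (hDH _ (e i).2) (hStgtX hy) hy0
  have hNpos : 0 < F.card := hFne.card_pos
  have : Nonempty (Fin F.card) := ⟨⟨0, hNpos⟩⟩
  refine ⟨F.card, K, hNpos, fun i => ⟨hcen i, hctrl i, hdur i, ?_, ?_, rfl, hρ.trans (hrad i)⟩,
    ?_, ?_⟩
  · exact ENNReal.ofReal_toReal (optHitTime_ne_top hreach (hcen i))
  · have h := (hS.hitTime_spec (hcen i) (hctrl i).1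
      ((hctrl i).2 ▸ optHitTime_ne_top hreach (hcen i))).2.1
    rwa [(hctrl i).toReal_hitTime] at h
  · refine exists_inAt_of_energy_cover hS hS₀ hS₀X herg hnull htgt (fun i => (hctrl i).1) hdur hρ
      hrad ?_ ?_
    · intro E hE hE0
      obtain ⟨E', hE', p, hp, hpE, hpc⟩ := hcov E hE hE0
      exact ⟨F.equivFin ⟨E', hE'⟩, p, hp, hpE, by simpa [K, e] using hpc⟩
    · obtain ⟨i₀, hi₀⟩ := Finite.exists_min fun i => (K i).duration
      refine ⟨v₀ * (K i₀).duration, mul_pos hv₀ (hdur i₀), fun i x hx hxi => ?_⟩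
      have h1 := hS.DH_flow_le (v₀ := v₀) hreach (hcen i) (hctrl i) hx
        ((normDist_le_one_iff (hρ.trans (hrad i))).1 hxi)
      exact h1.trans (sub_le_sub_left (mul_le_mul_of_nonneg_left (hi₀ i) hv₀.le) _)
  · have hsub : ∀ E ∈ F, ∀ x ∈ S.X, ‖x - c E‖ ≤ ρ → x ∈ Supp K ∩ S.X := by
      intro E hE x hx hxE
      refine ⟨mem_iUnion.2 ⟨F.equivFin ⟨E, hE⟩, ?_⟩, hx⟩
      rw [Metric.mem_closedBall, dist_eq_norm]
      exact le_trans (by simpa [K, e] using hxE) (hrad _).le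
    have hSne : (Supp K ∩ S.X).Nonempty := by
      obtain ⟨E, hE⟩ := hFne
      exact ⟨c E, hsub E hE _ (hFc E hE).1 (by simpa using hρ.le)⟩
    have hcomp := isCompact_Supp_inter.image_of_continuousOn
      (hgrad.continuousOn.mono (inter_subset_right (s := Supp K)))
    obtain ⟨H₁, hH₁⟩ := hcomp.exists_isLeast (hSne.image _)
    obtain ⟨H₂, hH₂⟩ := hcomp.exists_isGreatest (hSne.image _)
    refine ⟨H₁, H₂, hH₁, hH₂, ?_⟩
    have h := hcard H₁ H₂ fun E hE x hx hxE =>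
      ⟨hH₁.2 (mem_image_of_mem _ (hsub E hE x hx hxE)),
        hH₂.2 (mem_image_of_mem _ (hsub E hE x hx hxE))⟩
    have h2 : (F.card : ℝ) ≤ 2 * (H₂ - H₁) / (μH / 2 * ρ ^ 2) := by
      rwa [le_div_iff₀ (by positivity)]
    refine h2.trans_eq ?_
    have h3 : Real.exp (2 * L * (LH * Metric.diam S.X + ε) / S.minRate Stgt ε)
        = Real.exp (L * (LH * Metric.diam S.X + ε) / S.minRate Stgt ε) ^ 2 := by
      rw [← Real.exp_nat_mul]
      congr 1
      push_cast
      ring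
    rw [h3, hρdef, radiusBound]
    generalize Real.exp (L * (LH * Metric.diam S.X + ε) / S.minRate Stgt ε) = X at hexp
    generalize 1 - v₀ / S.minRate Stgt ε = q at hq
    have hX0 : 0 < X := by linarith
    field_simp
    ring
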